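/- Tensors are elements of $\mathbb C^a\otimes\mathbb C^b\otimes\mathbb C^c$ for natural numbers $a,b,c$. For tensors $S,T$ (possibly of different formats) write $S\le T$ if $S=(A\otimes B\otimes C)T$ for some complex matrices $A,B,C$, and $S\lesssim T$ (asymptotic restriction) if there is a function $f:\mathbb N\to\mathbb N$ with $f(n)/n\to0$ as $n\to\infty$ such that $S^{\boxtimes n}\le T^{\boxtimes(n+f(n))}$ for every $n$, where $\boxtimes$ is the Kronecker product. View $T\in\mathbb C^a\otimes\mathbb C^b\otimes\mathbb C^c$ as linear maps $T_1:\mathbb C^a\to\mathbb C^b\otimes\mathbb C^c$, $T_2:\mathbb C^b\to\mathbb C^a\otimes\mathbb C^c$, $T_3:\mathbb C^c\to\mathbb C^a\otimes\mathbb C^b$, and for $T\ne0$ put $\mu_i(T)=T_i^*T_i/\operatorname{Tr}(T_i^*T_i)$. The moment polytope $\Delta(T)$ is the set of triples $(\operatorname{spec}\mu_1(S)\mid\operatorname{spec}\mu_2(S)\mid\operatorname{spec}\mu_3(S))$, where $S$ ranges over the non-zero elements of the Euclidean closure of the orbit $(\mathrm{GL}_a\times\mathrm{GL}_b\times\mathrm{GL}_c)\cdot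 T$ and $\operatorname{spec}$ lists the eigenvalues with multiplicity in non-increasing order. Moment polytopes of tensors of different formats are compared after padding each of the three components with zeros. Let $\langle r\rangle=\sum_{i=1}^r e_i\otimes e_i\otimes e_i$, $\mathsf M_{n_1,n_2,n_3}=\sum_{i=1}^{n_1}\sum_{j=1}^{n_2}\sum_{k=1}^{n_3}e_{i,j}\otimes e_{j,k}\otimes e_{k,i}\in\mathbb C^{n_1n_2}\otimes\mathbb C^{n_2n_3}\otimes\mathbb C^{n_3n_1}$, and $\mathsf M_m=\mathsf M_{m,m,m}$. Theorem. There are tensors $S$ and $T$ such that $S\lesssim T$ but $\Delta(S)\not\subseteq\Delta(T)$. More specifically: (1) Let $T=e_1\wedge e_2\wedge e_3=\sum_{\pi\in S_3}\operatorname{sgn}(\pi)\,e_{\pi(1)}\otimes e_{\pi(2)}\otimes e_{\pi(3)}\in\mathbb C^3\otimes\mathbb C^3\otimes\mathbb C^3$. Then $\mathsf M_{1,1,3}\lesssim T$ but $\Delta(\mathsf M_{1,1,3})\not\subseteq\Delta(T)$. Moreover, every linear combination $\big(\sum_i\beta_iT_{i,j,k}\big)_{j,k}$, $\beta\in\mathbb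 C^3$, of the slices of $T$ is a singular $3\times3$ matrix; the support of $T$ is tight, that is, there are injective maps $f_1,f_2,f_3:\{1,2,3\}\to\mathbb Z$ with $f_1(i)+f_2(j)+f_3(k)=0$ whenever $T_{i,j,k}\neq0$; and $\langle3\rangle\lesssim T$. (2) For every integer $m\ge2$, $\langle m^2\rangle\lesssim\mathsf M_m$ but $\Delta(\langle m^2\rangle)\not\subseteq\Delta(\mathsf M_m)$. -/

import Mathlib

noncomputable section

namespace TensorMP

/-- The space `ℂ^α ⊗ ℂ^β ⊗ ℂ^γ` of order-three tensors in coordinates; `ℂ^a ⊗ ℂ^b ⊗ ℂ^c` is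
`Tensor (Fin a) (Fin b) (Fin c)`. -/
abbrev Tensor (α β γ : Type) : Type := α → β → γ → ℂ

section Constructions

variable {α β γ α' β' γ' : Type}

/-- The standard basis tensor `e_i ⊗ e_j ⊗ e_k`. -/
def basisTensor [DecidableEq α] [DecidableEq β] [DecidableEq γ] (i : α) (j : β) (k : γ) :
    Tensor α β γ :=
  fun i' j' k' => if i' = i ∧ j' = j ∧ k' = k then 1 else 0

/-- The action `(A ⊗ B ⊗ C) T` of a triple of (not necessarily square) matrices. -/
def act [Fintype α] [Fintype β] [Fintype γ] (A : Matrix α' α ℂ) (B : Matrix β' β ℂ)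
    (C : Matrix γ' γ ℂ) (T : Tensor α β γ) : Tensor α' β' γ' :=
  fun i' j' k' => ∑ i, ∑ j, ∑ k, A i' i * B j' j * C k' k * T i j k

/-- `Restricts S T` is the restriction preorder `S ≤ T`: `S = (A ⊗ B ⊗ C) T` for some matrices. -/
def Restricts [Fintype α] [Fintype β] [Fintype γ] (S : Tensor α' β' γ') (T : Tensor α β γ) : Prop :=
  ∃ (A : Matrix α' α ℂ) (B : Matrix β' β ℂ) (C : Matrix γ' γ ℂ), S = act A B C T

/-- The `n`-th Kronecker power `T^{⊠ n}`, whose three index sets are the sets of `n`-tuples. -/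
def kronPow (T : Tensor α β γ) (n : ℕ) : Tensor (Fin n → α) (Fin n → β) (Fin n → γ) :=
  fun i j k => ∏ t, T (i t) (j t) (k t)

/-- `AsympRestricts S T` is the asymptotic restriction preorder `S ≲ T`: there is `f` with
`f n / n → 0` and `S^{⊠ n} ≤ T^{⊠ (n + f n)}` for every `n`. -/
def AsympRestricts [Fintype α] [Fintype β] [Fintype γ]
    (S : Tensor α' β' γ') (T : Tensor α β γ) : Prop :=
  ∃ f : ℕ → ℕ,
    Filter.Tendsto (fun n : ℕ => (f n : ℝ) / (n : ℝ)) Filter.atTop (nhds 0) ∧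
    ∀ n : ℕ, Restricts (kronPow S n) (kronPow T (n + f n))

/-- The support of `T` is tight: there are injective integer labellings of the three index sets
whose labels sum to zero on the support. -/
def TightSupport (T : Tensor α β γ) : Prop :=
  ∃ (f₁ : α → ℤ) (f₂ : β → ℤ) (f₃ : γ → ℤ),
    Function.Injective f₁ ∧ Function.Injective f₂ ∧ Function.Injective f₃ ∧
    ∀ i j k, T i j k ≠ 0 → f₁ i + f₂ j + f₃ k = 0

/-- The combination `(x ⊗ I ⊗ I) T` of the slices of `T` along the first factor. -/
def sliceComb [Fintype α] (x : α → ℂ) (T : Tensor α β γ) : Matrix β γ ℂ :=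
  Matrix.of fun j k => ∑ i, x i * T i j k

/-- The matrix of `T₁ : ℂ^α → ℂ^β ⊗ ℂ^γ`. -/
def flat₁ (T : Tensor α β γ) : Matrix (β × γ) α ℂ := Matrix.of fun p i => T i p.1 p.2

/-- The matrix of `T₂ : ℂ^β → ℂ^α ⊗ ℂ^γ`. -/
def flat₂ (T : Tensor α β γ) : Matrix (α × γ) β ℂ := Matrix.of fun p j => T p.1 j p.2

/-- The matrix of `T₃ : ℂ^γ → ℂ^α ⊗ ℂ^β`. -/
def flat₃ (T : Tensor α β γ) : Matrix (α × β) γ ℂ := Matrix.of fun p k => T p.1 p.2 k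

end Constructions

section Spectra

/-- The normalized Gram matrix `F* F / Tr (F* F)`. -/
def normGram {ρ n : Type} [Fintype ρ] [Fintype n] (F : Matrix ρ n ℂ) : Matrix n n ℂ :=
  (F.conjTranspose * F).trace⁻¹ • (F.conjTranspose * F)

theorem normGram_isHermitian {ρ n : Type} [Fintype ρ] [Fintype n] (F : Matrix ρ n ℂ) :
    (normGram F).IsHermitian := by
  have h : (F.conjTranspose * F).IsHermitian := Matrix.isHermitian_conjTranspose_mul_self F
  have ht : star (F.conjTranspose * F).trace = (F.conjTranspose * F).trace := by
    rw [← Matrix.trace_conjTranspose, h.eq]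
  unfold normGram Matrix.IsHermitian
  rw [Matrix.conjTranspose_smul, h.eq, star_inv₀, ht]

/-- The eigenvalues (with multiplicity) of a Hermitian matrix in non-increasing order, padded with
zeros to an infinite sequence. In this way spectra of matrices of different sizes are compared
up to padding with zeros. -/
def spec {n : Type} [Fintype n] [DecidableEq n] (M : Matrix n n ℂ) (hM : M.IsHermitian) : ℕ → ℝ :=
  fun i => if h : i < Fintype.card n then hM.eigenvalues₀ ⟨i, h⟩ else 0

end Spectra

section Polytope

variable {α β γ : Type} [Fintype α] [Fintype β] [Fintype γ]
  [DecidableEq α] [DecidableEq β] [DecidableEq γ]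

/-- `spec (μ T)`, where `μ T = (μ₁ T, μ₂ T, μ₃ T)` with `μᵢ T = Tᵢ* Tᵢ / Tr (Tᵢ* Tᵢ)` is the
moment map; each of the three components is padded with zeros. -/
def specMoment (T : Tensor α β γ) : (ℕ → ℝ) × (ℕ → ℝ) × (ℕ → ℝ) :=
  (spec (normGram (flat₁ T)) (normGram_isHermitian _),
   spec (normGram (flat₂ T)) (normGram_isHermitian _),
   spec (normGram (flat₃ T)) (normGram_isHermitian _))

/-- The orbit of `T` under `GL_α × GL_β × GL_γ`. -/
def orbit (T : Tensor α β γ) : Set (Tensor α β γ) :=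
  {S | ∃ (A : Matrix.GeneralLinearGroup α ℂ) (B : Matrix.GeneralLinearGroup β ℂ)
    (C : Matrix.GeneralLinearGroup γ ℂ),
    S = act (A : Matrix α α ℂ) (B : Matrix β β ℂ) (C : Matrix γ γ ℂ) T}

/-- The moment polytope `Δ(T)`: the points `spec (μ S)` for the non-zero `S` in the (Euclidean)
closure of the `GL`-orbit of `T`, with the three components padded with zeros. -/
def momentPolytope (T : Tensor α β γ) : Set ((ℕ → ℝ) × (ℕ → ℝ) × (ℕ → ℝ)) :=
  {p | ∃ S ∈ closure (orbit T), S ≠ 0 ∧ p = specMoment S}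

end Polytope

section Examples

/-- The unit tensor `⟨r⟩ = ∑ᵢ eᵢ ⊗ eᵢ ⊗ eᵢ`. -/
def unitTensor (r : ℕ) : Tensor (Fin r) (Fin r) (Fin r) := ∑ i, basisTensor i i i

/-- The matrix multiplication tensor `∑ e_{i,j} ⊗ e_{j,k} ⊗ e_{k,i}` in
`ℂ^{n₁n₂} ⊗ ℂ^{n₂n₃} ⊗ ℂ^{n₃n₁}`, with pairs of indices flattened along the rows. -/
def matMulTensor (n₁ n₂ n₃ : ℕ) : Tensor (Fin (n₁ * n₂)) (Fin (n₂ * n₃)) (Fin (n₃ * n₁)) :=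
  ∑ i : Fin n₁, ∑ j : Fin n₂, ∑ k : Fin n₃,
    basisTensor (finProdFinEquiv (i, j)) (finProdFinEquiv (j, k)) (finProdFinEquiv (k, i))

/-- The tensor `e₁ ∧ e₂ ∧ e₃` in `ℂ³ ⊗ ℂ³ ⊗ ℂ³` (indices start at `0`). -/
def wedgeTensor : Tensor (Fin 3) (Fin 3) (Fin 3) :=
  basisTensor 0 1 2 - basisTensor 0 2 1 + basisTensor 1 2 0
    - basisTensor 1 0 2 + basisTensor 2 0 1 - basisTensor 2 1 0

end Examples

end TensorMP

end

noncomputable section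

namespace TensorMP

/-! ### What padded spectra remember: rank, and having a single nonzero eigenvalue. -/

section Spectra

variable {n n' : Type} [Fintype n] [DecidableEq n] [Fintype n'] [DecidableEq n']

/-! Both non-inclusions come from a property of slices that survives passage to the orbit closure.

Every slice combination of the wedge tensor is singular, and so is every one of a tensor `S` in its
orbit closure. If `S` had the spectra of `matMulTensor 1 1 3`, its first flattening would have rank
one, so `S` would be a vector tensored with one of its own slice combinations. A left kernel vector
of that matrix then kills the second flattening, which should have rank 3.

A slice combination of the matrix multiplication tensor is, up to reindexing, `Y ⊗ I`. Every pencil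
of matrices `Y` contains a singular one, so every pencil of slices contains one of corank at least
`m ≥ 2`. In the limit this still gives, for any subspace `E` of codimension at most one, a nonzero
`v ∈ E` killed by a slice of the pencil (`HasCorankTwoPencils.exists_of_mem_closure_orbit`). Let `S`
have first flattening of rank at most two, second marginal with only nonzero eigenvalue `a` and
corank at most one, and third marginal `b • 1`. With `E` the range of the second marginal,
contracting `S` with `v` leaves a rank one matrix, and Cauchy–Schwarz forces `a ≤ b`
(`HasCorankTwoPencils.le_of_mem_closure_orbit`). The unit tensor of size `n + 1` degenerates to
`balancedPencil n`, which has `a = 1/n` and `b = 1/(n+1)`.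

The asymptotic restrictions come from large families in the support of `T^{⊠ N}` whose indices
recombine to no further support point. Both families use Behrend's progression-free sets. For matrix
multiplication they are Ruzsa–Szemerédi triangles, about `m^{2N}` of them up to a subexponential
factor. For the wedge tensor, affine hashing modulo a prime of order `2^N` keeps about `3^N` of the
`6^N` support points. Since `matMulTensor 1 1 3` and all its powers are restrictions of those of
`⟨3⟩`, its case follows. -/

theorem spec_eq_eigenvalues (M : Matrix n n ℂ) (hM : M.IsHermitian) (i : n) :
    spec M hM ((Fintype.equivOfCardEq (Fintype.card_fin _) : Fin (Fintype.card n) ≃ n).symm i)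
      = hM.eigenvalues i := by
  simp [spec, Matrix.IsHermitian.eigenvalues]

theorem rank_eq_ncard_support_spec (M : Matrix n n ℂ) (hM : M.IsHermitian) :
    M.rank = (Function.support (spec M hM)).ncard := by
  classical
  rw [hM.rank_eq_card_non_zero_eigs, ← Nat.card_eq_fintype_card]
  symm
  let e : Fin (Fintype.card n) ≃ n := Fintype.equivOfCardEq (Fintype.card_fin _)
  rw [← Nat.card_coe_set_eq]
  refine Nat.card_congr (Equiv.symm (Equiv.ofBijective
    (fun i : {i // hM.eigenvalues i ≠ 0} =>
      (⟨(e.symm i.1 : ℕ), by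
        rw [Function.mem_support]; exact (spec_eq_eigenvalues M hM i.1) ▸ i.2⟩ :
          Function.support (spec M hM))) ⟨?_, ?_⟩))
  · intro i j h
    simpa [Subtype.ext_iff, Fin.ext_iff.symm] using h
  · rintro ⟨k, hk⟩
    have hk' : k < Fintype.card n := by
      by_contra hc
      exact hk (by simp [spec, hc])
    refine ⟨⟨e ⟨k, hk'⟩, ?_⟩, ?_⟩
    · rw [← spec_eq_eigenvalues M hM]
      simpa [e] using hk
    · simp

theorem rank_eq_of_spec_eq {M : Matrix n n ℂ} {hM : M.IsHermitian} {N : Matrix n' n' ℂ}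
    {hN : N.IsHermitian} (h : spec M hM = spec N hN) : M.rank = N.rank := by
  rw [rank_eq_ncard_support_spec M hM, rank_eq_ncard_support_spec N hN, h]

/-- Diagonalization reduces both sides to each eigenvalue being `0` or `c`. Stated through the
padded sequence, the condition can be carried between matrices of different sizes, as zeros satisfy
it. -/
theorem mul_self_eq_smul_iff_spec (M : Matrix n n ℂ) (hM : M.IsHermitian) (c : ℝ) :
    M * M = (c : ℂ) • M ↔ ∀ i, spec M hM i * spec M hM i = c * spec M hM i := by
  constructor
  · intro h i
    by_cases hi : i < Fintype.card n
    · let e : Fin (Fintype.card n) ≃ n := Fintype.equivOfCardEq (Fintype.card_fin _)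
      have h1 := spec_eq_eigenvalues M hM (e ⟨i, hi⟩)
      simp only [e, Equiv.symm_apply_apply] at h1
      rw [h1]
      set j := e ⟨i, hi⟩
      have hv := hM.mulVec_eigenvectorBasis j
      set v := (hM.eigenvectorBasis j).ofLp
      have hv0 : v ≠ 0 := by
        intro h0
        have := hM.eigenvectorBasis.orthonormal.ne_zero j
        exact this (by ext k; exact congrFun h0 k)
      have h2 : (M * M).mulVec v = ((c : ℂ) • M).mulVec v := by rw [h]
      rw [← Matrix.mulVec_mulVec, hv, Matrix.mulVec_smul, Matrix.smul_mulVec, hv] at h2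
      obtain ⟨k, hk⟩ := Function.ne_iff.1 hv0
      have h3 := congrFun h2 k
      simp only [Pi.smul_apply, Complex.real_smul, smul_eq_mul] at h3
      have h4 : ((hM.eigenvalues j : ℂ) * (hM.eigenvalues j) - c * (hM.eigenvalues j)) * v k = 0 := by
        linear_combination h3
      rcases mul_eq_zero.1 h4 with h5 | h5
      · exact_mod_cast sub_eq_zero.1 h5
      · exact absurd h5 hk
    · simp [spec, hi]
  · intro h
    have hd : ∀ i, hM.eigenvalues i * hM.eigenvalues i = c * hM.eigenvalues i := fun i => by
      rw [← spec_eq_eigenvalues M hM]; exact h _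
    set D : Matrix n n ℂ := Matrix.diagonal (RCLike.ofReal ∘ hM.eigenvalues) with hD
    have hDD : D * D = (c : ℂ) • D := by
      rw [hD, Matrix.diagonal_mul_diagonal, ← Matrix.diagonal_smul]
      congr 1
      ext i
      simpa using congrArg (fun x : ℝ => (x : ℂ)) (hd i)
    have hs := hM.spectral_theorem
    rw [← hD] at hs
    rw [hs, ← map_mul, hDD, map_smul]

theorem mul_self_eq_smul_of_spec_eq {M : Matrix n n ℂ} {hM : M.IsHermitian} {N : Matrix n' n' ℂ}
    {hN : N.IsHermitian} (h : spec M hM = spec N hN) (c : ℝ) (hc : M * M = (c : ℂ) • M) :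
    N * N = (c : ℂ) • N := by
  rw [mul_self_eq_smul_iff_spec N hN, ← h, ← mul_self_eq_smul_iff_spec M hM]
  exact hc

open scoped ComplexOrder

variable {ρ : Type} [Fintype ρ]

omit [DecidableEq n] in
theorem trace_conjTranspose_mul_self_ne_zero {F : Matrix ρ n ℂ} (hF : F ≠ 0) :
    (F.conjTranspose * F).trace ≠ 0 := by
  intro h
  exact hF (Matrix.trace_conjTranspose_mul_self_eq_zero_iff.1 h)

omit [DecidableEq n] in
theorem rank_normGram {F : Matrix ρ n ℂ} (hF : F ≠ 0) : (normGram F).rank = F.rank := by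
  have h := trace_conjTranspose_mul_self_ne_zero hF
  rw [← Matrix.rank_conjTranspose_mul_self F, normGram]
  exact Matrix.rank_smul_of_mem_nonZeroDivisors _ (mem_nonZeroDivisors_of_ne_zero (inv_ne_zero h))

end Spectra

section Flat

variable {α β γ : Type}

theorem flat₁_ne_zero {T : Tensor α β γ} (h : T ≠ 0) : flat₁ T ≠ 0 := fun h0 =>
  h (by ext i j k; exact congrFun (congrFun h0 (j, k)) i)

theorem flat₂_ne_zero {T : Tensor α β γ} (h : T ≠ 0) : flat₂ T ≠ 0 := fun h0 =>
  h (by ext i j k; exact congrFun (congrFun h0 (i, k)) j)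

end Flat

/-! ### Restriction, and degeneration inside the orbit closure. -/

section Action

variable {α β γ α' β' γ' α'' β'' γ'' : Type} [Fintype α] [Fintype β] [Fintype γ]
  [Fintype α'] [Fintype β'] [Fintype γ']

theorem sum_mul_sum_mul_sum_mul (f : α → ℂ) (g : β → ℂ) (h : γ → ℂ) (t : ℂ) :
    (∑ i, f i) * (∑ j, g j) * (∑ k, h k) * t = ∑ i, ∑ j, ∑ k, f i * g j * h k * t := by
  rw [Finset.sum_mul_sum]
  simp_rw [Finset.sum_mul, Finset.mul_sum, Finset.sum_mul]

theorem act_act (A : Matrix α' α ℂ) (B : Matrix β' β ℂ) (C : Matrix γ' γ ℂ)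
    (A' : Matrix α'' α' ℂ) (B' : Matrix β'' β' ℂ) (C' : Matrix γ'' γ' ℂ) (T : Tensor α β γ) :
    act A' B' C' (act A B C T) = act (A' * A) (B' * B) (C' * C) T := by
  ext i'' j'' k''
  calc _ = ∑ p' : α' × β' × γ', ∑ p : α × β × γ, A' i'' p'.1 * B' j'' p'.2.1 * C' k'' p'.2.2 *
        (A p'.1 p.1 * B p'.2.1 p.2.1 * C p'.2.2 p.2.2 * T p.1 p.2.1 p.2.2) := by
        simp only [act, Fintype.sum_prod_type, Finset.mul_sum]
    _ = ∑ p : α × β × γ, ∑ p' : α' × β' × γ', A' i'' p'.1 * B' j'' p'.2.1 * C' k'' p'.2.2 *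
        (A p'.1 p.1 * B p'.2.1 p.2.1 * C p'.2.2 p.2.2 * T p.1 p.2.1 p.2.2) := Finset.sum_comm
    _ = _ := by
        simp only [Fintype.sum_prod_type, act, Matrix.mul_apply, sum_mul_sum_mul_sum_mul]
        refine Finset.sum_congr rfl fun i _ => Finset.sum_congr rfl fun j _ =>
          Finset.sum_congr rfl fun k _ => Finset.sum_congr rfl fun i' _ =>
          Finset.sum_congr rfl fun j' _ => Finset.sum_congr rfl fun k' _ => ?_
        ring

theorem Restricts.trans {S : Tensor α'' β'' γ''} {T : Tensor α' β' γ'} {U : Tensor α β γ}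
    (h : Restricts S T) (h' : Restricts T U) : Restricts S U := by
  obtain ⟨A, B, C, rfl⟩ := h
  obtain ⟨A', B', C', rfl⟩ := h'
  exact ⟨_, _, _, act_act _ _ _ _ _ _ _⟩

theorem AsympRestricts.of_kronPow_restricts {S : Tensor α'' β'' γ''} {T : Tensor α' β' γ'}
    {U : Tensor α β γ} (h : ∀ n, Restricts (kronPow S n) (kronPow T n)) (h' : AsympRestricts T U) :
    AsympRestricts S U := by
  classical
  obtain ⟨f, hf, h'⟩ := h'
  exact ⟨f, hf, fun n => (h n).trans (h' n)⟩

omit [Fintype α'] [Fintype β'] [Fintype γ'] in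
theorem continuous_act {X : Type*} [TopologicalSpace X] {A : X → Matrix α' α ℂ}
    {B : X → Matrix β' β ℂ} {C : X → Matrix γ' γ ℂ} {T : X → Tensor α β γ} (hA : Continuous A)
    (hB : Continuous B) (hC : Continuous C) (hT : Continuous T) :
    Continuous fun x => act (A x) (B x) (C x) (T x) := by
  unfold act
  refine continuous_pi fun i => continuous_pi fun j => continuous_pi fun k => ?_
  refine continuous_finsetSum _ fun i' _ => continuous_finsetSum _ fun j' _ =>
    continuous_finsetSum _ fun k' _ => ?_
  have h1 := hA.matrix_elem i i'
  have h2 := hB.matrix_elem j j'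
  have h3 := hC.matrix_elem k k'
  have h4 := ((continuous_pi_iff.1 ((continuous_pi_iff.1 ((continuous_pi_iff.1 hT) i')) j')) k')
  exact ((h1.mul h2).mul h3).mul h4

/-- The determinant of `A + ε` is the characteristic polynomial of `-A` at `ε`, so only finitely
many `ε` are bad. -/
theorem eventually_isUnit_add_smul_one [DecidableEq α] (A : Matrix α α ℂ) :
    ∀ᶠ ε : ℂ in nhdsWithin 0 {0}ᶜ, IsUnit (A + ε • (1 : Matrix α α ℂ)) := by
  have h : {ε : ℂ | ¬ IsUnit (A + ε • (1 : Matrix α α ℂ))}.Finite := by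
    refine ((-A).charpoly.roots.toFinset.finite_toSet).subset fun ε hε => ?_
    simp only [Set.mem_ofPred_eq, Matrix.isUnit_iff_isUnit_det, isUnit_iff_ne_zero, not_not] at hε
    rw [Finset.mem_coe, Multiset.mem_toFinset, Polynomial.mem_roots (Matrix.charpoly_monic _).ne_zero,
      Polynomial.IsRoot, Matrix.eval_charpoly, ← hε]
    congr 1
    rw [sub_neg_eq_add, add_comm]
    congr 1
    ext i j
    simp [Matrix.scalar_apply, Matrix.diagonal_apply, Matrix.one_apply]
  have h2 := (h.subset (Set.sdiff_subset (t := {0}))).isClosed.isOpen_compl.mem_nhds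
    (show (0 : ℂ) ∈ ({ε : ℂ | ¬ IsUnit (A + ε • (1 : Matrix α α ℂ))} \ {0})ᶜ by simp)
  filter_upwards [nhdsWithin_le_nhds h2, self_mem_nhdsWithin] with ε h3 h4
  by_contra h5
  exact h3 ⟨h5, h4⟩

/-- Every restriction of `T` to its own format lies in the closure of the orbit. -/
theorem act_mem_closure_orbit [DecidableEq α] [DecidableEq β] [DecidableEq γ] (A : Matrix α α ℂ)
    (B : Matrix β β ℂ) (C : Matrix γ γ ℂ) (T : Tensor α β γ) :
    act A B C T ∈ closure (orbit T) := by
  have hc : Continuous fun ε : ℂ => act (A + ε • (1 : Matrix α α ℂ)) (B + ε • (1 : Matrix β β ℂ))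
      (C + ε • (1 : Matrix γ γ ℂ)) T :=
    continuous_act (by fun_prop) (by fun_prop) (by fun_prop) continuous_const
  have ht := (hc.tendsto 0).mono_left (nhdsWithin_le_nhds (s := {0}ᶜ))
  simp only [zero_smul, add_zero] at ht
  refine mem_closure_of_tendsto ht ?_
  filter_upwards [eventually_isUnit_add_smul_one A, eventually_isUnit_add_smul_one B,
    eventually_isUnit_add_smul_one C] with ε hA hB hC
  exact ⟨hA.unit, hB.unit, hC.unit, rfl⟩

end Action

/-! ### Entries of the matrix multiplication and unit tensors. -/

section MatMul

variable {n₁ n₂ n₃ : ℕ}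

theorem matMulTensor_apply (a : Fin n₁ × Fin n₂) (b : Fin n₂ × Fin n₃) (c : Fin n₃ × Fin n₁) :
    matMulTensor n₁ n₂ n₃ (finProdFinEquiv a) (finProdFinEquiv b) (finProdFinEquiv c) =
      if a.2 = b.1 ∧ b.2 = c.1 ∧ c.2 = a.1 then 1 else 0 := by
  obtain ⟨a1, a2⟩ := a
  obtain ⟨b1, b2⟩ := b
  obtain ⟨c1, c2⟩ := c
  simp only [matMulTensor, Finset.sum_apply, basisTensor, EmbeddingLike.apply_eq_iff_eq,
    Prod.mk.injEq]
  rw [Finset.sum_eq_single a1 (fun i _ hi => Finset.sum_eq_zero fun j _ => Finset.sum_eq_zero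
      fun k _ => if_neg fun h => hi h.1.1.symm) (by simp),
    Finset.sum_eq_single a2 (fun j _ hj => Finset.sum_eq_zero
      fun k _ => if_neg fun h => hj h.1.2.symm) (by simp),
    Finset.sum_eq_single b2 (fun k _ hk => if_neg fun h => hk h.2.1.2.symm) (by simp)]
  refine if_congr ?_ rfl rfl
  constructor
  · rintro ⟨-, h1, h2⟩
    exact ⟨h1.1.symm, h2.1.symm, h2.2⟩
  · rintro ⟨h1, h2, h3⟩
    exact ⟨⟨rfl, rfl⟩, ⟨h1.symm, rfl⟩, h2.symm, h3⟩

theorem unitTensor_apply {r : ℕ} (i j k : Fin r) :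
    unitTensor r i j k = if i = j ∧ j = k then 1 else 0 := by
  simp only [unitTensor, Finset.sum_apply, basisTensor]
  rw [Finset.sum_eq_single i (fun l _ hl => if_neg fun h => hl h.1.symm) (by simp)]
  refine if_congr ?_ rfl rfl
  constructor
  · rintro ⟨-, h1, h2⟩
    exact ⟨h1.symm, h1.trans h2.symm⟩
  · rintro ⟨rfl, rfl⟩
    exact ⟨rfl, rfl, rfl⟩

end MatMul

/-! ### Slice combinations under the action and in the limit. -/

section Slices

variable {α β γ α' β' γ' : Type} [Fintype α] [Fintype β] [Fintype γ]

theorem sliceComb_act (A : Matrix α' α ℂ) (B : Matrix β' β ℂ) (C : Matrix γ' γ ℂ)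
    (T : Tensor α β γ) [Fintype α'] (x : α' → ℂ) :
    sliceComb x (act A B C T) = B * sliceComb (Matrix.vecMul x A) T * C.transpose := by
  ext j' k'
  simp only [sliceComb, act, Matrix.of_apply, Matrix.mul_apply, Matrix.transpose_apply,
    Matrix.vecMul, dotProduct]
  calc _ = ∑ i', ∑ p : α × β × γ, x i' * (A i' p.1 * B j' p.2.1 * C k' p.2.2 * T p.1 p.2.1 p.2.2) := by
        simp only [Fintype.sum_prod_type, Finset.mul_sum]
    _ = ∑ p : α × β × γ, ∑ i', x i' * (A i' p.1 * B j' p.2.1 * C k' p.2.2 * T p.1 p.2.1 p.2.2) :=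
        Finset.sum_comm
    _ = ∑ p : γ × β × α, ∑ i', B j' p.2.1 * (x i' * A i' p.2.2 * T p.2.2 p.2.1 p.1) * C k' p.1 := by
        refine Fintype.sum_equiv ⟨fun p => (p.2.2, p.2.1, p.1), fun p => (p.2.2, p.2.1, p.1),
          fun _ => rfl, fun _ => rfl⟩ _ _ fun p => Finset.sum_congr rfl fun i' _ => ?_
        simp only [Equiv.coe_fn_mk]
        ring
    _ = _ := by
        simp only [Fintype.sum_prod_type, Finset.mul_sum, Finset.sum_mul]

omit [Fintype β] [Fintype γ] in
theorem continuous_sliceComb {X : Type*} [TopologicalSpace X] {x : X → α → ℂ}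
    {T : X → Tensor α β γ} (hx : Continuous x) (hT : Continuous T) :
    Continuous fun s => sliceComb (x s) (T s) := by
  refine continuous_matrix fun j k => ?_
  simp only [sliceComb, Matrix.of_apply]
  exact continuous_finsetSum _ fun i _ => ((continuous_pi_iff.1 hx) i).mul
    (continuous_pi_iff.1 ((continuous_pi_iff.1 ((continuous_pi_iff.1 hT) i)) j) k)

theorem self_mem_closure_orbit [DecidableEq α] [DecidableEq β] [DecidableEq γ]
    (T : Tensor α β γ) : T ∈ closure (orbit T) := by
  refine subset_closure ⟨1, 1, 1, ?_⟩
  ext i j k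
  simp [act, Matrix.one_apply]

/-- Acting on `T` turns a slice combination into another one multiplied by matrices on both sides,
and vanishing of a determinant is a closed condition. -/
theorem det_sliceComb_eq_zero_of_mem_closure_orbit [DecidableEq α] [DecidableEq β] {T : Tensor α β β}
    (hT : ∀ x, (sliceComb x T).det = 0) {S : Tensor α β β} (hS : S ∈ closure (orbit T))
    (x : α → ℂ) : (sliceComb x S).det = 0 := by
  have hcl : IsClosed {S : Tensor α β β | (sliceComb x S).det = 0} :=
    isClosed_eq (continuous_sliceComb continuous_const continuous_id).matrix_det continuous_const
  refine closure_minimal ?_ hcl hS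
  rintro _ ⟨A, B, C, rfl⟩
  rw [Set.mem_ofPred_eq, sliceComb_act, Matrix.det_mul, Matrix.det_mul, hT]
  simp

end Slices

/-! ### The wedge tensor and the first non-inclusion. -/

theorem det_sliceComb_wedgeTensor (x : Fin 3 → ℂ) : (sliceComb x wedgeTensor).det = 0 := by
  rw [Matrix.det_fin_three]
  simp [sliceComb, Fin.sum_univ_three, wedgeTensor, basisTensor]
  ring

theorem tightSupport_wedgeTensor : TightSupport wedgeTensor := by
  refine ⟨fun i => (i : ℤ) - 1, fun i => (i : ℤ) - 1, fun i => (i : ℤ) - 1, ?_, ?_, ?_, ?_⟩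
  · intro i j h; simpa [Fin.ext_iff] using h
  · intro i j h; simpa [Fin.ext_iff] using h
  · intro i j h; simpa [Fin.ext_iff] using h
  · intro i j k
    fin_cases i <;> fin_cases j <;> fin_cases k <;> simp [wedgeTensor, basisTensor]

/-- The columns of `F * X` form a basis of the column space and `P` holds coordinates in it. For `F
= flat₁ S` those columns are slice combinations of `S` itself, so `S` is built from `k` of its own
slices. -/
theorem exists_eq_mul_mul_of_rank_eq {ρ n : Type} [Fintype n] [DecidableEq n] [Finite ρ] {k : ℕ}
    (F : Matrix ρ n ℂ) (hF : F.rank = k) :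
    ∃ (X : Matrix n (Fin k) ℂ) (P : Matrix (Fin k) n ℂ), F * X * P = F := by
  let b := Module.finBasisOfFinrankEq ℂ (LinearMap.range F.mulVecLin) hF
  choose x hx using fun l => (b l).2
  refine ⟨Matrix.of fun i l => x l i,
    Matrix.of fun l i => b.repr ⟨F.mulVecLin (Pi.single i 1), ⟨_, rfl⟩⟩ l, ?_⟩
  ext p i
  have h := b.sum_repr ⟨F.mulVecLin (Pi.single i 1), ⟨_, rfl⟩⟩
  have h2 := congrFun (congrArg Subtype.val h) p
  simp only [Matrix.mulVecLin_apply, Matrix.mulVec_single, MulOpposite.op_one, one_smul,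
    AddSubmonoidClass.coe_finsetSum, Submodule.coe_smul, Finset.sum_apply, Pi.smul_apply,
    smul_eq_mul, Matrix.col_apply] at h2
  rw [← h2, Matrix.mul_apply]
  refine Finset.sum_congr rfl fun l _ => ?_
  have h3 := congrFun (hx l) p
  rw [Matrix.mulVecLin_apply] at h3
  rw [← h3, mul_comm]
  simp [Matrix.mul_apply, Matrix.mulVec, dotProduct]

theorem rank_flat₁_matMulTensor_one_one_three : (flat₁ (matMulTensor 1 1 3)).rank ≤ 1 := by
  simpa using Matrix.rank_le_card_width (flat₁ (matMulTensor 1 1 3))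

theorem matMulTensor_ne_zero {n₁ n₂ n₃ : ℕ} [NeZero n₁] [NeZero n₂] [NeZero n₃] :
    matMulTensor n₁ n₂ n₃ ≠ 0 := by
  intro h
  have h1 := matMulTensor_apply (n₁ := n₁) (n₂ := n₂) (n₃ := n₃) (0, 0) (0, 0) (0, 0)
  rw [h] at h1
  simp at h1

theorem rank_eq_card_of_mulVec_injective {ρ n : Type} [Fintype n] [Finite ρ]
    {F : Matrix ρ n ℂ} (hF : ∀ v, F.mulVec v = 0 → v = 0) : F.rank = Fintype.card n := by
  rw [Matrix.rank, LinearMap.finrank_range_of_inj, Module.finrank_fintype_fun_eq_card]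
  exact (injective_iff_map_eq_zero F.mulVecLin).2 hF

theorem mulVec_eq_zero_of_rank_eq_card {ρ n : Type} [Fintype n] [Finite ρ]
    {F : Matrix ρ n ℂ} (hF : F.rank = Fintype.card n) (v : n → ℂ) (hv : F.mulVec v = 0) : v = 0 := by
  have h := F.mulVecLin.finrank_range_add_finrank_ker
  rw [Module.finrank_fintype_fun_eq_card] at h
  have h2 : Module.finrank ℂ (LinearMap.ker F.mulVecLin) = 0 := by
    unfold Matrix.rank at hF
    omega
  rw [Submodule.finrank_eq_zero] at h2
  have : v ∈ LinearMap.ker F.mulVecLin := hv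
  rwa [h2] at this

theorem rank_flat₂_matMulTensor_one_one_three : (flat₂ (matMulTensor 1 1 3)).rank = 3 := by
  rw [rank_eq_card_of_mulVec_injective]
  · simp
  intro v hv
  ext j
  obtain ⟨⟨j1, j2⟩, rfl⟩ := finProdFinEquiv.surjective j
  have h := congrFun hv (finProdFinEquiv (0, 0), finProdFinEquiv (j2, 0))
  rw [Matrix.mulVec, dotProduct, ← finProdFinEquiv.sum_comp, Fintype.sum_prod_type] at h
  simp only [flat₂, Matrix.of_apply, matMulTensor_apply] at h
  simpa [Subsingleton.elim j1 0] using h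

theorem momentPolytope_matMulTensor_one_one_three_not_subset :
    ¬ momentPolytope (matMulTensor 1 1 3) ⊆ momentPolytope wedgeTensor := by
  intro hsub
  have hne : matMulTensor 1 1 3 ≠ 0 := matMulTensor_ne_zero
  have hmem : matMulTensor 1 1 3 ∈ closure (orbit (matMulTensor 1 1 3)) :=
    self_mem_closure_orbit _
  obtain ⟨S, hS, hS0, hp⟩ := hsub ⟨_, hmem, hne, rfl⟩
  have h1 := rank_eq_of_spec_eq (congrArg Prod.fst hp)
  have h2 := rank_eq_of_spec_eq (congrArg (fun q => q.2.1) hp)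
  rw [rank_normGram (flat₁_ne_zero hne), rank_normGram (flat₁_ne_zero hS0)] at h1
  rw [rank_normGram (flat₂_ne_zero hne), rank_normGram (flat₂_ne_zero hS0),
    rank_flat₂_matMulTensor_one_one_three] at h2
  have h1' : (flat₁ (matMulTensor 1 1 3)).rank = 1 :=
    le_antisymm rank_flat₁_matMulTensor_one_one_three (Nat.one_le_iff_ne_zero.2 fun h0 => ?_)
  swap
  · rw [h0] at h1
    obtain ⟨X, P, hXP⟩ := exists_eq_mul_mul_of_rank_eq _ h1.symm
    apply flat₁_ne_zero hS0
    rw [← hXP]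
    ext i j
    simp [Matrix.mul_apply]
  -- Rank one makes `S` the product of the row `P` with the single slice combination given by the
  -- column of `X`; a left kernel vector of that slice is then killed by `flat₂ S`.
  obtain ⟨X, P, hXP⟩ := exists_eq_mul_mul_of_rank_eq _ (h1.symm.trans h1')
  have hdet := det_sliceComb_eq_zero_of_mem_closure_orbit det_sliceComb_wedgeTensor hS
    (fun i => X i 0)
  obtain ⟨v, hv0, hv⟩ := Matrix.exists_vecMul_eq_zero_iff.2 hdet
  refine hv0 (mulVec_eq_zero_of_rank_eq_card (F := flat₂ S) (by simpa using h2.symm) v ?_)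
  ext ⟨i, k⟩
  have hSi : ∀ j, S i j k = sliceComb (fun i => X i 0) S j k * P 0 i := fun j => by
    have := congrFun (congrFun hXP (j, k)) i
    rw [Matrix.mul_apply, Fin.sum_univ_one, Matrix.mul_apply] at this
    simp only [flat₁, Matrix.of_apply] at this
    rw [← this, sliceComb, Matrix.of_apply]
    simp only [mul_comm]
  have hk := congrFun hv k
  simp only [Matrix.vecMul, dotProduct, Pi.zero_apply] at hk
  simp only [Matrix.mulVec, dotProduct, flat₂, Matrix.of_apply, hSi, Pi.zero_apply]
  calc _ = (∑ j, v j * sliceComb (fun i => X i 0) S j k) * P 0 i := by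
        rw [Finset.sum_mul]
        exact Finset.sum_congr rfl fun j _ => by ring
    _ = 0 := by rw [hk, zero_mul]

/-! ### Pencils of slices with corank two, and their limits. -/

section Pencil

variable {α β γ : Type} [Fintype α] [Fintype β] [Fintype γ]

/-- Every pencil of slices of `T` contains a slice whose left kernel has dimension at least two. -/
def HasCorankTwoPencils (T : Tensor α β γ) : Prop :=
  ∀ X : Matrix α (Fin 2) ℂ, ∃ c : Fin 2 → ℂ, c ≠ 0 ∧ ∃ V : Submodule ℂ (β → ℂ),
    2 ≤ Module.finrank ℂ V ∧ ∀ v ∈ V, Matrix.vecMul v (sliceComb (X.mulVec c) T) = 0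

theorem exists_ne_zero_mem_inf {V E : Submodule ℂ (β → ℂ)}
    (h : Fintype.card β < Module.finrank ℂ V + Module.finrank ℂ E) : ∃ v ∈ V, v ∈ E ∧ v ≠ 0 := by
  have h1 := Submodule.finrank_sup_add_finrank_inf_eq V E
  have h2 := (V ⊔ E).finrank_le
  rw [Module.finrank_fintype_fun_eq_card] at h2
  have h3 : V ⊓ E ≠ ⊥ := fun h0 => by
    rw [h0, finrank_bot] at h1
    omega
  obtain ⟨v, hv, hv0⟩ := Submodule.exists_mem_ne_zero_of_ne_bot h3
  exact ⟨v, hv.1, hv.2, hv0⟩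

theorem HasCorankTwoPencils.exists_of_mem_orbit [DecidableEq α] [DecidableEq β] [DecidableEq γ]
    {T S : Tensor α β γ}
    (hT : HasCorankTwoPencils T) (hS : S ∈ orbit T) (X : Matrix α (Fin 2) ℂ)
    (E : Submodule ℂ (β → ℂ)) (hE : Fintype.card β ≤ Module.finrank ℂ E + 1) :
    ∃ c : Fin 2 → ℂ, c ≠ 0 ∧ ∃ v ∈ E, v ≠ 0 ∧
      Matrix.vecMul v (sliceComb (X.mulVec c) S) = 0 := by
  obtain ⟨A, B, C, rfl⟩ := hS
  obtain ⟨c, hc, V, hV, hVT⟩ := hT ((A : Matrix α α ℂ).transpose * X)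
  have hB' : ((B⁻¹ : Matrix.GeneralLinearGroup β ℂ) : Matrix β β ℂ) * (B : Matrix β β ℂ) = 1 := by
    rw [← Units.val_mul]; simp
  let φ : (β → ℂ) →ₗ[ℂ] (β → ℂ) :=
    Matrix.vecMulLinear ((B⁻¹ : Matrix.GeneralLinearGroup β ℂ) : Matrix β β ℂ)
  have hφ : Function.Injective φ := by
    intro u w h
    have h2 := congrArg (fun z => Matrix.vecMul z (B : Matrix β β ℂ)) h
    simpa [φ, Matrix.vecMul_vecMul, hB'] using h2
  -- The left kernel transforms by `B⁻¹`, so it keeps dimension at least two and must meet a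
  -- subspace of codimension at most one.
  obtain ⟨v, hv, hvE, hv0⟩ := exists_ne_zero_mem_inf (V := V.map φ) (E := E) (by
    rw [← (Submodule.equivMapOfInjective φ hφ V).finrank_eq]
    omega)
  refine ⟨c, hc, v, hvE, hv0, ?_⟩
  obtain ⟨u, hu, rfl⟩ := hv
  rw [sliceComb_act, ← Matrix.vecMul_vecMul, ← Matrix.vecMul_vecMul]
  have h1 : Matrix.vecMul (φ u) (B : Matrix β β ℂ) = u := by
    simp [φ, Matrix.vecMul_vecMul]
  have h2 : Matrix.vecMul (X.mulVec c) (A : Matrix α α ℂ) =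
      ((A : Matrix α α ℂ).transpose * X).mulVec c := by
    rw [← Matrix.mulVec_mulVec, Matrix.mulVec_transpose]
  rw [h1, h2, hVT u hu, Matrix.zero_vecMul]

/-- Fixing `E` replaces a two-dimensional kernel by a single vector, so compactness of unit spheres
suffices: `c` and `v` can be normalized, and projecting a closed set along a compact factor gives a
closed set. -/
theorem HasCorankTwoPencils.exists_of_mem_closure_orbit [DecidableEq α] [DecidableEq β]
    [DecidableEq γ] {T S : Tensor α β γ}
    (hT : HasCorankTwoPencils T) (hS : S ∈ closure (orbit T)) (X : Matrix α (Fin 2) ℂ)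
    (E : Submodule ℂ (β → ℂ)) (hE : Fintype.card β ≤ Module.finrank ℂ E + 1) :
    ∃ c : Fin 2 → ℂ, c ≠ 0 ∧ ∃ v ∈ E, v ≠ 0 ∧
      Matrix.vecMul v (sliceComb (X.mulVec c) S) = 0 := by
  let K : Set ((Fin 2 → ℂ) × (β → ℂ)) :=
    Metric.sphere 0 1 ×ˢ (Metric.sphere 0 1 ∩ (E : Set (β → ℂ)))
  have hK : IsCompact K :=
    (isCompact_sphere 0 1).prod ((isCompact_sphere 0 1).inter_right E.closed_of_finiteDimensional)
  have : CompactSpace K := isCompact_iff_compactSpace.1 hK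
  let Z : Set (Tensor α β γ × K) :=
    {q | Matrix.vecMul q.2.1.2 (sliceComb (X.mulVec q.2.1.1) q.1) = 0}
  have hZ : IsClosed Z := by
    have h1 : Continuous fun q : Tensor α β γ × K => sliceComb (X.mulVec q.2.1.1) q.1 :=
      continuous_sliceComb (by fun_prop) continuous_fst
    exact isClosed_eq (Continuous.matrix_vecMul (by fun_prop) h1) continuous_const
  have hcl := isClosedMap_fst_of_compactSpace Z hZ
  have hsub : closure (orbit T) ⊆ Prod.fst '' Z := by
    refine closure_minimal (fun S hS => ?_) hcl
    obtain ⟨c, hc, v, hvE, hv0, h⟩ := hT.exists_of_mem_orbit hS X E hE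
    have hc' : (‖c‖ : ℂ) ≠ 0 := by simpa using hc
    have hv' : (‖v‖ : ℂ) ≠ 0 := by simpa using hv0
    refine ⟨(S, ⟨((‖c‖ : ℂ)⁻¹ • c, (‖v‖ : ℂ)⁻¹ • v), ?_, ?_, E.smul_mem _ hvE⟩), ?_, rfl⟩
    · simp [norm_smul, hc]
    · simp [norm_smul, hv0]
    · have hs : ∀ (a : ℂ) (x : α → ℂ), sliceComb (a • x) S = a • sliceComb x S := fun a x => by
        ext j k
        simp [sliceComb, Finset.mul_sum, mul_assoc]
      simp only [Z, Set.mem_ofPred_eq]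
      rw [Matrix.mulVec_smul, hs, Matrix.vecMul_smul, Matrix.smul_vecMul, h]
      simp
  obtain ⟨⟨S', ⟨⟨c, v⟩, hc, hv, hvE⟩⟩, hq, rfl⟩ := hsub hS
  exact ⟨c, ne_zero_of_mem_unit_sphere ⟨c, hc⟩, v, hvE, ne_zero_of_mem_unit_sphere ⟨v, hv⟩, hq⟩

end Pencil

/-- If `Y₁` is invertible, an eigenvalue `t` of `Y₀ * Y₁⁻¹` makes `t • Y₁ - Y₀` singular; otherwise
`Y₁` itself serves. -/
theorem exists_ne_zero_det_pencil_eq_zero {m : ℕ} (hm : 0 < m) (Y₀ Y₁ : Matrix (Fin m) (Fin m) ℂ) :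
    ∃ c : Fin 2 → ℂ, c ≠ 0 ∧ (c 0 • Y₀ + c 1 • Y₁).det = 0 := by
  by_cases h : Y₁.det = 0
  · exact ⟨![0, 1], fun h0 => by simpa using congrFun h0 1, by simpa using h⟩
  · have hdeg : (Y₀ * Y₁⁻¹).charpoly.degree ≠ 0 := by
      rw [Matrix.charpoly_degree_eq_dim, Fintype.card_fin]
      exact_mod_cast hm.ne'
    obtain ⟨t, ht⟩ := IsAlgClosed.exists_root _ hdeg
    refine ⟨![-1, t], fun h0 => by simpa using congrFun h0 0, ?_⟩
    rw [Polynomial.IsRoot, Matrix.eval_charpoly] at ht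
    have h2 : (![-1, t] : Fin 2 → ℂ) 0 • Y₀ + (![-1, t] : Fin 2 → ℂ) 1 • Y₁ =
        (Matrix.scalar (Fin m) t - Y₀ * Y₁⁻¹) * Y₁ := by
      rw [sub_mul, Matrix.mul_assoc, Matrix.nonsing_inv_mul _ (isUnit_iff_ne_zero.2 h)]
      simp [Matrix.scalar_apply, ← Matrix.smul_eq_diagonal_mul]
      abel
    rw [h2, Matrix.det_mul, ht, zero_mul]

theorem hasCorankTwoPencils_matMulTensor {m : ℕ} (hm : 2 ≤ m) :
    HasCorankTwoPencils (matMulTensor m m m) := by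
  intro X
  let Y : Fin 2 → Matrix (Fin m) (Fin m) ℂ := fun l =>
    Matrix.of fun i j => X (finProdFinEquiv (i, j)) l
  obtain ⟨c, hc, hdet⟩ := exists_ne_zero_det_pencil_eq_zero (by omega) (Y 0) (Y 1)
  obtain ⟨z, hz0, hz⟩ := Matrix.exists_mulVec_eq_zero_iff.2 hdet
  -- The slice acts as `Y ⊗ I`, so `z ⊗ u` lies in its left kernel for every `u` once `Y z = 0`;
  -- this gives `m` dimensions.
  let φ : (Fin m → ℂ) →ₗ[ℂ] (Fin (m * m) → ℂ) :=
    { toFun := fun u b => z (finProdFinEquiv.symm b).1 * u (finProdFinEquiv.symm b).2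
      map_add' := fun u w => by ext b; simp [mul_add]
      map_smul' := fun a u => by ext b; simp; ring }
  have hφ : Function.Injective φ := by
    intro u w h
    obtain ⟨j, hj⟩ := Function.ne_iff.1 hz0
    ext k
    have := congrFun h (finProdFinEquiv (j, k))
    simp only [φ, LinearMap.coe_mk, AddHom.coe_mk, Equiv.symm_apply_apply] at this
    exact mul_left_cancel₀ hj this
  refine ⟨c, hc, LinearMap.range φ, ?_, ?_⟩
  · rw [LinearMap.finrank_range_of_inj hφ]
    simpa using hm
  · rintro _ ⟨u, rfl⟩
    ext q
    obtain ⟨⟨k, i⟩, rfl⟩ := finProdFinEquiv.surjective q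
    rw [Matrix.vecMul, dotProduct, ← finProdFinEquiv.sum_comp, Fintype.sum_prod_type]
    have h : ∀ j k', sliceComb (X.mulVec c) (matMulTensor m m m) (finProdFinEquiv (j, k'))
        (finProdFinEquiv (k, i)) = if k' = k then (c 0 • Y 0 + c 1 • Y 1) i j else 0 := by
      intro j k'
      rw [sliceComb, Matrix.of_apply, ← finProdFinEquiv.sum_comp, Fintype.sum_prod_type,
        Finset.sum_eq_single i, Finset.sum_eq_single j]
      · simp only [matMulTensor_apply, Matrix.mulVec, dotProduct, Fin.sum_univ_two]
        simp [Y, mul_comm]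
      · intro j' _ hj'
        simp [matMulTensor_apply, hj']
      · simp
      · intro i' _ hi'
        simp [matMulTensor_apply, Ne.symm hi']
      · simp
    have hzi := congrFun hz i
    simp only [Matrix.mulVec, dotProduct, Pi.zero_apply] at hzi
    simp only [h, φ, LinearMap.coe_mk, AddHom.coe_mk, Equiv.symm_apply_apply, mul_ite, mul_zero,
      Finset.sum_ite_eq', Finset.mem_univ, if_true, Pi.zero_apply]
    calc _ = u k * ∑ j, (c 0 • Y 0 + c 1 • Y 1) i j * z j := by
          rw [Finset.mul_sum]
          exact Finset.sum_congr rfl fun j _ => by ring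
      _ = 0 := by rw [hzi, mul_zero]

/-! ### Cauchy–Schwarz for unnormalized marginals. -/

section Gram

variable {α β γ : Type} [Fintype α] [Fintype β] [Fintype γ]

/-- The squared Hilbert-Schmidt norm of a tensor. -/
def sqNorm (S : Tensor α β γ) : ℝ := ∑ i, ∑ j, ∑ k, ‖S i j k‖ ^ 2

theorem trace_conjTranspose_mul_self_eq {ρ n : Type} [Fintype ρ] [Fintype n] (F : Matrix ρ n ℂ) :
    (F.conjTranspose * F).trace = ((∑ i, ∑ p, ‖F p i‖ ^ 2 : ℝ) : ℂ) := by
  simp [Matrix.trace, Matrix.mul_apply, Complex.conj_mul']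

theorem trace_flat₁ (S : Tensor α β γ) :
    ((flat₁ S).conjTranspose * flat₁ S).trace = (sqNorm S : ℂ) := by
  rw [trace_conjTranspose_mul_self_eq, sqNorm]
  simp only [Fintype.sum_prod_type, flat₁, Matrix.of_apply]

theorem trace_flat₂ (S : Tensor α β γ) :
    ((flat₂ S).conjTranspose * flat₂ S).trace = (sqNorm S : ℂ) := by
  rw [trace_conjTranspose_mul_self_eq, sqNorm]
  simp only [Fintype.sum_prod_type, flat₂, Matrix.of_apply]
  rw [Finset.sum_comm]

theorem trace_flat₃ (S : Tensor α β γ) :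
    ((flat₃ S).conjTranspose * flat₃ S).trace = (sqNorm S : ℂ) := by
  rw [trace_conjTranspose_mul_self_eq, sqNorm]
  simp only [Fintype.sum_prod_type, flat₃, Matrix.of_apply]
  rw [Finset.sum_comm]
  refine congrArg _ (Finset.sum_congr rfl fun i _ => Finset.sum_comm)

theorem sqNorm_pos {S : Tensor α β γ} (hS : S ≠ 0) : 0 < sqNorm S := by
  have h0 : 0 ≤ sqNorm S := by unfold sqNorm; positivity
  refine lt_of_le_of_ne h0 fun h => ?_
  have := trace_conjTranspose_mul_self_ne_zero (flat₁_ne_zero hS)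
  rw [trace_flat₁, ← h] at this
  simp at this

theorem sum_norm_mulVec_sq {ρ n : Type} [Fintype ρ] [Fintype n] [DecidableEq n] (F : Matrix ρ n ℂ)
    (v : n → ℂ) (a : ℝ) (h : (F.conjTranspose * F).mulVec v = (a : ℂ) • v) :
    ∑ p, ‖F.mulVec v p‖ ^ 2 = a * ∑ i, ‖v i‖ ^ 2 := by
  have h1 : star (F.mulVec v) ⬝ᵥ F.mulVec v = (a : ℂ) * (star v ⬝ᵥ v) := by
    rw [Matrix.star_mulVec, ← Matrix.dotProduct_mulVec, Matrix.mulVec_mulVec, h,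
      dotProduct_smul, smul_eq_mul]
  have h2 : ∀ {ι : Type} [Fintype ι] (u : ι → ℂ), star u ⬝ᵥ u = ((∑ i, ‖u i‖ ^ 2 : ℝ) : ℂ) := by
    intro ι _ u
    simp [dotProduct, Complex.conj_mul']
  rw [h2, h2] at h1
  exact_mod_cast h1

/-- If contracting `S` with an eigenvector of the second Gram matrix gives a rank one matrix, then
the eigenvalue is bounded by the third Gram matrix. -/
theorem eigenvalue_le_of_contraction_rank_one [DecidableEq β] [DecidableEq γ] (S : Tensor α β γ)
    {a b : ℝ} (ha : 0 < a) {v : β → ℂ} (hv : v ≠ 0)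
    (h₂ : ((flat₂ S).conjTranspose * flat₂ S).mulVec v = (a : ℂ) • v)
    (h₃ : (flat₃ S).conjTranspose * flat₃ S = (b : ℂ) • 1) (y : α → ℂ) (w : γ → ℂ)
    (hyw : ∀ i k, ∑ j, S i j k * v j = y i * w k) : a ≤ b := by
  have e2 := sum_norm_mulVec_sq (flat₂ S) v a h₂
  have e3 := sum_norm_mulVec_sq (flat₃ S) (star w) b (by rw [h₃, Matrix.smul_mulVec, Matrix.one_mulVec])
  simp only [Fintype.sum_prod_type, Matrix.mulVec, dotProduct, flat₂, flat₃, Matrix.of_apply, hyw,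
    norm_mul, mul_pow, Pi.star_apply, norm_star] at e2 e3
  simp only [← Finset.mul_sum, ← Finset.sum_mul] at e2
  set ny := ∑ i, ‖y i‖ ^ 2
  set nw := ∑ k, ‖w k‖ ^ 2
  set nv := ∑ j, ‖v j‖ ^ 2 with hnv
  have hnv0 : 0 < nv := by
    obtain ⟨j, hj⟩ := Function.ne_iff.1 hv
    have h1 : ‖v j‖ ^ 2 ≤ nv :=
      Finset.single_le_sum (f := fun j => ‖v j‖ ^ 2) (fun _ _ => by positivity) (Finset.mem_univ j)
    have h2 : 0 < ‖v j‖ := norm_pos_iff.2 hj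
    have h3 : 0 < ‖v j‖ ^ 2 := by positivity
    linarith
  -- The squared norm of the contraction `y ⊗ w`, rewritten as a pairing of `S` with `y`, `v` and
  -- `w` in which `w` is contracted first.
  have key : ((ny * nw : ℝ) : ℂ) =
      ∑ p : α × β, (star (y p.1) * v p.2) * ∑ k, S p.1 p.2 k * star (w k) := by
    calc ((ny * nw : ℝ) : ℂ) = ∑ i, ∑ k, star (y i) * star (w k) * (y i * w k) := by
          simp only [ny, nw]
          push_cast
          rw [Finset.sum_mul_sum]
          refine Finset.sum_congr rfl fun i _ => Finset.sum_congr rfl fun k _ => ?_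
          rw [← Complex.conj_mul', ← Complex.conj_mul']
          simp only [RCLike.star_def]
          ring
      _ = ∑ i, ∑ k, ∑ j, star (y i) * star (w k) * (S i j k * v j) := by
          simp only [← hyw, Finset.mul_sum]
      _ = ∑ i, ∑ j, ∑ k, star (y i) * star (w k) * (S i j k * v j) :=
          Finset.sum_congr rfl fun i _ => Finset.sum_comm
      _ = _ := by
          simp only [Fintype.sum_prod_type, Finset.mul_sum]
          refine Finset.sum_congr rfl fun i _ => Finset.sum_congr rfl fun j _ =>
            Finset.sum_congr rfl fun k _ => ?_
          ring
  -- Cauchy–Schwarz over the first two indices, with `e3` evaluating the contraction of `S` against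
  -- `star w`. Since `ny * nw = a * nv` by `e2`, cancelling leaves `a ≤ b`.
  have hcs : (ny * nw) ^ 2 ≤ (ny * nv) * (b * nw) := by
    have h1 : ny * nw ≤ ∑ p : α × β, ‖star (y p.1) * v p.2‖ * ‖∑ k, S p.1 p.2 k * star (w k)‖ := by
      have h2 : ny * nw ≤ ‖((ny * nw : ℝ) : ℂ)‖ := by
        rw [Complex.norm_real]; exact le_abs_self _
      refine h2.trans ?_
      rw [key]
      refine (norm_sum_le _ _).trans (le_of_eq ?_)
      exact Finset.sum_congr rfl fun p _ => norm_mul _ _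
    have h0 : 0 ≤ ny * nw := by positivity
    refine (pow_le_pow_left₀ h0 h1 2).trans ((Finset.sum_mul_sq_le_sq_mul_sq _ _ _).trans
      (le_of_eq ?_))
    rw [← e3]
    simp only [Fintype.sum_prod_type, norm_mul, norm_star, mul_pow, ny, nv, Finset.sum_mul_sum]
  rw [e2] at hcs
  have hb : ny * nv * (b * nw) = b * nv * (ny * nw) := by ring
  rw [hb, e2, sq] at hcs
  have hpos : 0 < a * nv := by positivity
  have := le_of_mul_le_mul_right hcs hpos
  exact le_of_mul_le_mul_right this hnv0

end Gram

/-! ### The inequality separating the two moment polytopes. -/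

section Separation

variable {α β γ : Type} [Fintype α] [Fintype β] [Fintype γ] [DecidableEq α] [DecidableEq β]
  [DecidableEq γ]

theorem exists_eq_mul_mul_of_rank_le {ρ n : Type} [Fintype n] [DecidableEq n] [Finite ρ] {k : ℕ}
    (F : Matrix ρ n ℂ) (hF : F.rank ≤ k) :
    ∃ (X : Matrix n (Fin k) ℂ) (P : Matrix (Fin k) n ℂ), F * X * P = F := by
  obtain ⟨X, P, h⟩ := exists_eq_mul_mul_of_rank_eq F rfl
  let J : Matrix (Fin F.rank) (Fin k) ℂ := Matrix.of fun l l' => if Fin.castLE hF l = l' then 1 else 0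
  have hJ : J * J.transpose = 1 := by
    ext l l'
    simp [J, Matrix.mul_apply, Matrix.one_apply, eq_comm]
  refine ⟨X * J, J.transpose * P, ?_⟩
  calc F * (X * J) * (J.transpose * P) = F * X * (J * J.transpose) * P := by
        simp only [Matrix.mul_assoc]
    _ = F := by rw [hJ, Matrix.mul_one, h]

/-- A separating condition on marginals for the orbit closure of a tensor whose pencils of slices
contain slices of corank two. -/
theorem HasCorankTwoPencils.le_of_mem_closure_orbit {T S : Tensor α β γ}
    (hT : HasCorankTwoPencils T) (hS : S ∈ closure (orbit T)) (hS0 : S ≠ 0)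
    (h₁ : (flat₁ S).rank ≤ 2) {a b : ℝ} (ha : 0 < a)
    (h₂ : normGram (flat₂ S) * normGram (flat₂ S) = (a : ℂ) • normGram (flat₂ S))
    (h₂' : Fintype.card β ≤ (flat₂ S).rank + 1)
    (h₃ : normGram (flat₃ S) = (b : ℂ) • 1) : a ≤ b := by
  obtain ⟨X, P, hXP⟩ := exists_eq_mul_mul_of_rank_le _ h₁
  -- By `h₂` every vector of this range is an eigenvector for `a`, so the kernel vector found in `E`
  -- is one as well.
  let E := LinearMap.range (normGram (flat₂ S)).mulVecLin
  have hE : Fintype.card β ≤ Module.finrank ℂ E + 1 := by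
    rwa [← rank_normGram (flat₂_ne_zero hS0)] at h₂'
  obtain ⟨c, hc, v, hvE, hv0, hv⟩ := hT.exists_of_mem_closure_orbit hS X E hE
  have hev : (normGram (flat₂ S)).mulVec v = (a : ℂ) • v := by
    obtain ⟨u, rfl⟩ := hvE
    rw [Matrix.mulVecLin_apply, Matrix.mulVec_mulVec, h₂, Matrix.smul_mulVec]
  have ht := sqNorm_pos hS0
  have htc : (sqNorm S : ℂ) ≠ 0 := by exact_mod_cast ht.ne'
  have g2 : ((flat₂ S).conjTranspose * flat₂ S).mulVec v = ((sqNorm S * a : ℝ) : ℂ) • v := by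
    rw [normGram, trace_flat₂, Matrix.smul_mulVec] at hev
    rw [Complex.ofReal_mul, mul_smul, ← hev, smul_smul, mul_inv_cancel₀ htc, one_smul]
  have g3 : (flat₃ S).conjTranspose * flat₃ S = ((sqNorm S * b : ℝ) : ℂ) • 1 := by
    rw [normGram, trace_flat₃] at h₃
    rw [Complex.ofReal_mul, mul_smul, ← h₃, smul_smul, mul_inv_cancel₀ htc, one_smul]
  let G : Fin 2 → γ → ℂ := fun l => Matrix.vecMul v (sliceComb (fun i => X i l) S)
  have hG : ∀ k, c 0 * G 0 k + c 1 * G 1 k = 0 := by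
    intro k
    have := congrFun hv k
    simp only [Matrix.vecMul, dotProduct, sliceComb, Matrix.of_apply, Matrix.mulVec,
      Fin.sum_univ_two, Pi.zero_apply] at this
    rw [← this]
    simp only [G, Matrix.vecMul, dotProduct, sliceComb, Matrix.of_apply, Finset.mul_sum,
      ← Finset.sum_add_distrib]
    refine Finset.sum_congr rfl fun j _ => Finset.sum_congr rfl fun i _ => ?_
    ring
  have hSv : ∀ i k, ∑ j, S i j k * v j = P 0 i * G 0 k + P 1 i * G 1 k := by
    intro i k
    have hSi : ∀ j, S i j k = P 0 i * sliceComb (fun i => X i 0) S j k +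
        P 1 i * sliceComb (fun i => X i 1) S j k := fun j => by
      have := congrFun (congrFun hXP (j, k)) i
      rw [Matrix.mul_apply, Fin.sum_univ_two, Matrix.mul_apply, Matrix.mul_apply] at this
      simp only [flat₁, Matrix.of_apply] at this
      rw [← this, sliceComb, sliceComb, Matrix.of_apply, Matrix.of_apply]
      simp only [mul_comm]
    simp only [hSi, G, Matrix.vecMul, dotProduct, Finset.mul_sum, ← Finset.sum_add_distrib]
    refine Finset.sum_congr rfl fun j _ => ?_
    ring
  -- The relation `c 0 * G 0 + c 1 * G 1 = 0` makes `G 0` and `G 1` proportional, so the contraction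
  -- `P 0 ⊗ G 0 + P 1 ⊗ G 1` has the form `y ⊗ w`; the case split picks the vector to keep.
  have hab : sqNorm S * a ≤ sqNorm S * b := by
    by_cases h0 : c 0 = 0
    · have h1 : c 1 ≠ 0 := fun h1 => hc (by ext l; fin_cases l <;> simpa)
      refine eigenvalue_le_of_contraction_rank_one S (by positivity) hv0 g2 g3 (P 0) (G 0) ?_
      intro i k
      have := hG k
      rw [h0, zero_mul, zero_add, mul_eq_zero] at this
      rw [hSv, this.resolve_left h1, mul_zero, add_zero]
    · refine eigenvalue_le_of_contraction_rank_one S (by positivity) hv0 g2 g3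
        (fun i => P 1 i - c 1 / c 0 * P 0 i) (G 1) ?_
      intro i k
      have h2 : G 0 k = - (c 1 / c 0) * G 1 k := by
        field_simp
        linear_combination hG k
      rw [hSv, h2]
      ring
  exact le_of_mul_le_mul_left hab ht

end Separation

/-! ### A degeneration of the unit tensor that violates the inequality. -/

section WeightedPencil

/-- Row weights of the balanced polynomial multiplication tensor. -/
def rowWeight (n : ℕ) (j : ℕ) : ℝ := √(((n - j : ℕ) : ℝ) * n.choose j)

/-- Column weights of the balanced polynomial multiplication tensor. -/
def colWeight (n : ℕ) (k : ℕ) : ℝ := (√(n.choose k : ℝ))⁻¹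

theorem rowWeight_self (n : ℕ) : rowWeight n n = 0 := by simp [rowWeight]

/-- Together with the next lemma, this balances the squared entries: position `(j, j)` carries `n -
j` and `(j, j+1)` carries `j + 1`. Rows `j < n` then sum to `n + 1` and every column sums to `n`. -/
theorem rowWeight_sq_mul_colWeight_sq {n j : ℕ} (hj : j ≤ n) :
    rowWeight n j ^ 2 * colWeight n j ^ 2 = ((n - j : ℕ) : ℝ) := by
  have h : (n.choose j : ℝ) ≠ 0 := by exact_mod_cast (Nat.choose_pos hj).ne'
  rw [rowWeight, colWeight, inv_pow, Real.sq_sqrt (by positivity), Real.sq_sqrt (by positivity)]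
  field_simp

theorem rowWeight_sq_mul_colWeight_succ_sq {n j : ℕ} (hj : j < n) :
    rowWeight n j ^ 2 * colWeight n (j + 1) ^ 2 = (j : ℝ) + 1 := by
  have h : (n.choose (j + 1) : ℝ) ≠ 0 := by exact_mod_cast (Nat.choose_pos hj).ne'
  have h2 : (n.choose (j + 1) : ℝ) * ((j : ℝ) + 1) = n.choose j * ((n - j : ℕ) : ℝ) := by
    exact_mod_cast Nat.choose_succ_right_eq n j
  rw [rowWeight, colWeight, inv_pow, Real.sq_sqrt (by positivity), Real.sq_sqrt (by positivity)]
  field_simp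
  linarith

/-- The tensor `∑ e_a ⊗ e_j ⊗ e_{a + j}` of multiplication of a linear polynomial with a polynomial
of degree less than `n`, rescaled so that all marginals are uniform on their supports. -/
def balancedPencil (n : ℕ) : Tensor (Fin (n + 1)) (Fin (n + 1)) (Fin (n + 1)) := fun i j k =>
  rowWeight n j * colWeight n k * if (i : ℕ) ≤ 1 ∧ (k : ℕ) = j + i then 1 else 0

theorem act_unitTensor {α β γ : Type} {r : ℕ} (A : Matrix α (Fin r) ℂ) (B : Matrix β (Fin r) ℂ)
    (C : Matrix γ (Fin r) ℂ) (i : α) (j : β) (k : γ) :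
    act A B C (unitTensor r) i j k = ∑ t, A i t * B j t * C k t := by
  simp only [act, unitTensor_apply]
  refine Finset.sum_congr rfl fun t _ => ?_
  rw [Finset.sum_eq_single t, Finset.sum_eq_single t]
  · simp
  · intro t' _ ht'
    simp [Ne.symm ht']
  · simp
  · intro t' _ ht'
    simp [Ne.symm ht']
  · simp

/-- Evaluation and interpolation: polynomials are multiplied by evaluating at the points `0, …, n`,
multiplying pointwise, and applying the inverse Vandermonde matrix. The evaluation matrices are
singular in general, so only the orbit closure is reached. -/
theorem balancedPencil_mem_closure_orbit (n : ℕ) :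
    balancedPencil n ∈ closure (orbit (unitTensor (n + 1))) := by
  let V : Matrix (Fin (n + 1)) (Fin (n + 1)) ℂ := Matrix.vandermonde fun t => ((t : ℕ) : ℂ)
  have hV : V⁻¹ * V = 1 := by
    refine Matrix.nonsing_inv_mul _ (isUnit_iff_ne_zero.2 (Matrix.det_vandermonde_ne_zero_iff.2 ?_))
    intro s t h
    simpa [Fin.ext_iff] using h
  have hVe : ∀ (k l : Fin (n + 1)), ∑ t : Fin (n + 1), V⁻¹ k t * ((t : ℕ) : ℂ) ^ (l : ℕ) =
      if k = l then 1 else 0 := fun k l => by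
    have := congrFun (congrFun hV k) l
    rwa [Matrix.mul_apply, Matrix.one_apply] at this
  have h := act_mem_closure_orbit
    (Matrix.of fun i t : Fin (n + 1) => if (i : ℕ) ≤ 1 then ((t : ℕ) : ℂ) ^ (i : ℕ) else 0)
    (Matrix.of fun j t : Fin (n + 1) => (rowWeight n j : ℂ) * ((t : ℕ) : ℂ) ^ (j : ℕ))
    (Matrix.of fun k t : Fin (n + 1) => (colWeight n k : ℂ) * V⁻¹ k t) (unitTensor (n + 1))
  convert h using 1
  ext i j k
  simp only [act_unitTensor, Matrix.of_apply, balancedPencil, ite_and]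
  by_cases hi : (i : ℕ) ≤ 1
  · simp only [if_pos hi]
    by_cases hji : (j : ℕ) + i ≤ n
    · have h1 := hVe k ⟨j + i, by omega⟩
      simp only [Fin.ext_iff] at h1
      calc _ = (rowWeight n j : ℂ) * colWeight n k * if (k : ℕ) = j + i then 1 else 0 := by
            split_ifs <;> simp
        _ = _ := by
          rw [← h1, Finset.mul_sum]
          refine Finset.sum_congr rfl fun t _ => ?_
          rw [pow_add]
          ring
    -- The product degree exceeds `n` only in row `n`, whose weight is zero.
    · have hjn : (j : ℕ) = n := by omega
      simp [hjn, rowWeight_self]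
  · simp [hi]

theorem balancedPencil_apply_zero_self (n : ℕ) (j : Fin (n + 1)) :
    ‖balancedPencil n 0 j j‖ ^ 2 = ((n - j : ℕ) : ℝ) := by
  rw [← rowWeight_sq_mul_colWeight_sq (Nat.lt_succ_iff.1 j.2)]
  simp [balancedPencil, mul_pow]

theorem balancedPencil_ne_zero {n : ℕ} (hn : 0 < n) : balancedPencil n ≠ 0 := by
  intro h
  have h1 := balancedPencil_apply_zero_self n 0
  rw [h] at h1
  simp only [Pi.zero_apply, norm_zero, Fin.val_zero, Nat.sub_zero] at h1
  have h2 : (0 : ℝ) < n := by exact_mod_cast hn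
  norm_num at h1
  linarith

theorem rank_flat₁_balancedPencil_le (n : ℕ) : (flat₁ (balancedPencil n)).rank ≤ 2 := by
  have h : flat₁ (balancedPencil n) =
      (Matrix.of fun p (a : Fin 2) => if ha : (a : ℕ) < n + 1 then balancedPencil n ⟨a, ha⟩ p.1 p.2
        else 0 : Matrix (Fin (n + 1) × Fin (n + 1)) (Fin 2) ℂ) *
      (Matrix.of fun a i => if (i : ℕ) = a then 1 else 0 : Matrix (Fin 2) (Fin (n + 1)) ℂ) := by
    ext p i
    rw [Matrix.mul_apply, Fin.sum_univ_two]
    simp only [flat₁, Matrix.of_apply]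
    by_cases h0 : (i : ℕ) = 0
    · obtain ⟨i, hi⟩ := i
      subst h0
      simp
    · by_cases h1 : (i : ℕ) = 1
      · have h2 : 0 < n := by omega
        obtain ⟨i, hi⟩ := i
        subst h1
        simp [h2]
      · have h2 : ¬ (i : ℕ) ≤ 1 := by omega
        simp [h0, h1, balancedPencil, h2]
  rw [h]
  exact (Matrix.rank_mul_le_left _ _).trans ((Matrix.rank_le_card_width _).trans (by simp))

theorem sum_fin_ite_eq_nat (n s : ℕ) (g : ℕ → ℝ) :
    ∑ k : Fin (n + 1), (if (k : ℕ) = s then g k else 0) = if s ≤ n then g s else 0 := by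
  split_ifs with h
  · rw [Finset.sum_eq_single ⟨s, by omega⟩]
    · simp
    · intro k _ hk
      rw [if_neg fun h => hk (Fin.ext h)]
    · simp
  · exact Finset.sum_eq_zero fun k _ => if_neg (by omega)

theorem sum_fin_ite_le_one {n : ℕ} (hn : 0 < n) (g : ℕ → ℝ) :
    ∑ i : Fin (n + 1), (if (i : ℕ) ≤ 1 then g i else 0) = g 0 + g 1 := by
  obtain ⟨n, rfl⟩ : ∃ n', n = n' + 1 := ⟨n - 1, by omega⟩
  rw [Fin.sum_univ_succ, Fin.sum_univ_succ]
  simp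

theorem norm_balancedPencil_sq (n : ℕ) (i j k : Fin (n + 1)) :
    ‖balancedPencil n i j k‖ ^ 2 = if (i : ℕ) ≤ 1 then
      (if (k : ℕ) = j + i then rowWeight n j ^ 2 * colWeight n k ^ 2 else 0) else 0 := by
  unfold balancedPencil
  split_ifs <;> simp_all [mul_pow]

theorem gram_flat₂_balancedPencil {n : ℕ} (hn : 0 < n) :
    (flat₂ (balancedPencil n)).conjTranspose * flat₂ (balancedPencil n) =
      Matrix.diagonal fun j : Fin (n + 1) => if (j : ℕ) < n then ((n : ℂ) + 1) else 0 := by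
  ext j j'
  rw [Matrix.mul_apply, Matrix.diagonal_apply]
  simp only [Matrix.conjTranspose_apply, flat₂, Matrix.of_apply]
  by_cases hj : j = j'
  · subst hj
    rw [if_pos rfl]
    simp only [RCLike.star_def, Complex.conj_mul', ← Complex.ofReal_pow]
    rw [← Complex.ofReal_sum, Fintype.sum_prod_type]
    simp only [norm_balancedPencil_sq]
    have h : ∀ i : Fin (n + 1), ∑ k : Fin (n + 1), (if (i : ℕ) ≤ 1 then
        (if (k : ℕ) = j + i then rowWeight n j ^ 2 * colWeight n k ^ 2 else 0) else 0) =
        if (i : ℕ) ≤ 1 then (if (j : ℕ) + i ≤ n then rowWeight n j ^ 2 * colWeight n (j + i) ^ 2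
          else 0) else 0 := fun i => by
      split_ifs with h1 h2
      · rw [sum_fin_ite_eq_nat n _ fun k => rowWeight n j ^ 2 * colWeight n k ^ 2, if_pos h2]
      · rw [sum_fin_ite_eq_nat n _ fun k => rowWeight n j ^ 2 * colWeight n k ^ 2, if_neg h2]
      · simp
    simp only [h]
    rw [sum_fin_ite_le_one hn fun i => if (j : ℕ) + i ≤ n then
      rowWeight n j ^ 2 * colWeight n (j + i) ^ 2 else 0]
    have hj2 := j.2
    by_cases hjn : (j : ℕ) < n
    · rw [if_pos hjn, if_pos (by omega), if_pos (by omega), add_zero,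
        rowWeight_sq_mul_colWeight_sq hjn.le, rowWeight_sq_mul_colWeight_succ_sq hjn,
        Nat.cast_sub hjn.le]
      push_cast
      ring
    · have hj3 : (j : ℕ) = n := by omega
      rw [if_neg hjn, hj3]
      simp [rowWeight_self]
  · rw [if_neg hj]
    refine Finset.sum_eq_zero fun p _ => ?_
    have : ¬ ((p.2 : ℕ) = j + p.1 ∧ (p.2 : ℕ) = j' + p.1) := fun h => hj (Fin.ext (by omega))
    simp only [balancedPencil]
    split_ifs <;> first | omega | simp

theorem gram_flat₃_balancedPencil {n : ℕ} (hn : 0 < n) :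
    (flat₃ (balancedPencil n)).conjTranspose * flat₃ (balancedPencil n) = (n : ℂ) • 1 := by
  ext k k'
  rw [Matrix.mul_apply, Matrix.smul_apply, Matrix.one_apply]
  simp only [Matrix.conjTranspose_apply, flat₃, Matrix.of_apply]
  by_cases hk : k = k'
  · subst hk
    rw [if_pos rfl]
    simp only [RCLike.star_def, Complex.conj_mul', ← Complex.ofReal_pow]
    rw [← Complex.ofReal_sum, Fintype.sum_prod_type]
    simp only [norm_balancedPencil_sq]
    have h : ∀ i : Fin (n + 1), ∑ j : Fin (n + 1), (if (i : ℕ) ≤ 1 then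
        (if (k : ℕ) = j + i then rowWeight n j ^ 2 * colWeight n k ^ 2 else 0) else 0) =
        if (i : ℕ) ≤ 1 then (if (i : ℕ) ≤ k then rowWeight n (k - i) ^ 2 * colWeight n k ^ 2
          else 0) else 0 := fun i => by
      split_ifs with h1 h2
      · have h3 := sum_fin_ite_eq_nat n (k - i) fun j => rowWeight n j ^ 2 * colWeight n k ^ 2
        rw [if_pos (by omega)] at h3
        rw [← h3]
        exact Finset.sum_congr rfl fun j _ => if_congr (by omega) rfl rfl
      · exact Finset.sum_eq_zero fun j _ => if_neg (by omega)
      · simp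
    simp only [h]
    rw [sum_fin_ite_le_one hn fun i => if i ≤ (k : ℕ) then
      rowWeight n (k - i) ^ 2 * colWeight n k ^ 2 else 0]
    have hk2 : (k : ℕ) ≤ n := by omega
    rw [if_pos (Nat.zero_le _), Nat.sub_zero, rowWeight_sq_mul_colWeight_sq hk2, Nat.cast_sub hk2]
    rcases hk3 : (k : ℕ) with - | l
    · simp
    · have := rowWeight_sq_mul_colWeight_succ_sq (n := n) (j := l) (by omega)
      rw [if_pos (by omega), Nat.add_sub_cancel, this]
      push_cast
      simp
  · rw [if_neg hk]
    simp only [smul_zero]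
    refine Finset.sum_eq_zero fun p _ => ?_
    have : ¬ ((k : ℕ) = p.2 + p.1 ∧ (k' : ℕ) = p.2 + p.1) := fun h => hk (Fin.ext (by omega))
    simp only [balancedPencil]
    split_ifs <;> first | omega | simp

theorem sqNorm_balancedPencil {n : ℕ} (hn : 0 < n) :
    (sqNorm (balancedPencil n) : ℂ) = n * (n + 1) := by
  rw [← trace_flat₃, gram_flat₃_balancedPencil hn]
  simp [Matrix.trace_smul]

theorem normGram_flat₃_balancedPencil {n : ℕ} (hn : 0 < n) :
    normGram (flat₃ (balancedPencil n)) = ((((n : ℝ) + 1)⁻¹ : ℝ) : ℂ) • 1 := by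
  have h : (n : ℂ) ≠ 0 := by exact_mod_cast hn.ne'
  have h' : (n : ℂ) + 1 ≠ 0 := by exact_mod_cast n.succ_ne_zero
  rw [normGram, trace_flat₃, gram_flat₃_balancedPencil hn, sqNorm_balancedPencil hn, smul_smul]
  congr 1
  push_cast
  field_simp

theorem normGram_flat₂_balancedPencil {n : ℕ} (hn : 0 < n) :
    normGram (flat₂ (balancedPencil n)) =
      Matrix.diagonal fun j : Fin (n + 1) => if (j : ℕ) < n then (((n : ℝ)⁻¹ : ℝ) : ℂ) else 0 := by
  have h : (n : ℂ) ≠ 0 := by exact_mod_cast hn.ne'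
  have h' : (n : ℂ) + 1 ≠ 0 := by exact_mod_cast n.succ_ne_zero
  rw [normGram, trace_flat₂, gram_flat₂_balancedPencil hn, sqNorm_balancedPencil hn,
    ← Matrix.diagonal_smul]
  congr 1
  ext j
  simp only [Pi.smul_apply, smul_eq_mul]
  split_ifs
  · push_cast
    field_simp
  · simp

theorem rank_normGram_flat₂_balancedPencil {n : ℕ} (hn : 0 < n) :
    (normGram (flat₂ (balancedPencil n))).rank = n := by
  have h : (n : ℂ) ≠ 0 := by exact_mod_cast hn.ne'
  rw [normGram_flat₂_balancedPencil hn, Matrix.rank_diagonal, Fintype.card_subtype]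
  have h2 : (Finset.univ.filter fun j : Fin (n + 1) =>
      (if (j : ℕ) < n then (((n : ℝ)⁻¹ : ℝ) : ℂ) else 0) ≠ 0) = Finset.univ.erase (Fin.last n) := by
    ext j
    simp only [Finset.mem_filter, Finset.mem_univ, true_and, Finset.mem_erase, and_true, ne_eq,
      ite_eq_right_iff, Fin.ext_iff, Fin.val_last]
    have hj := j.2
    constructor
    · intro h1 h2
      exact h1 fun h3 => by omega
    · intro h1 h2
      have := h2 (by omega)
      simp [h] at this
  rw [h2, Finset.card_erase_of_mem (Finset.mem_univ _)]
  simp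

end WeightedPencil

/-- Full rank allows cancelling `N` in `N * (N - c) = 0`. This recovers a uniform marginal from its
spectrum. -/
theorem eq_smul_one_of_mul_self_eq {r : ℕ} {N : Matrix (Fin r) (Fin r) ℂ} {c : ℂ}
    (h : N * N = c • N) (hr : N.rank = r) : N = c • 1 := by
  rw [← sub_eq_zero]
  ext i j
  have h1 : N.mulVec ((N - c • 1).mulVec (Pi.single j 1)) = 0 := by
    rw [Matrix.mulVec_mulVec, mul_sub, h, Matrix.mul_smul, Matrix.mul_one, sub_self,
      Matrix.zero_mulVec]
  have h2 := congrFun (mulVec_eq_zero_of_rank_eq_card (F := N) (by simpa using hr) _ h1) i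
  simpa using h2

theorem momentPolytope_unitTensor_not_subset {n : ℕ} (hn : 0 < n) {T : Tensor (Fin (n + 1))
    (Fin (n + 1)) (Fin (n + 1))} (hT : HasCorankTwoPencils T) :
    ¬ momentPolytope (unitTensor (n + 1)) ⊆ momentPolytope T := by
  intro hsub
  have hne := balancedPencil_ne_zero hn
  obtain ⟨S, hS, hS0, hp⟩ := hsub ⟨_, balancedPencil_mem_closure_orbit n, hne, rfl⟩
  have s1 := congrArg Prod.fst hp
  have s2 := congrArg (fun q => q.2.1) hp
  have s3 := congrArg (fun q => q.2.2) hp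
  have h1 := rank_eq_of_spec_eq s1
  rw [rank_normGram (flat₁_ne_zero hne), rank_normGram (flat₁_ne_zero hS0)] at h1
  have h2 := rank_eq_of_spec_eq s2
  rw [rank_normGram_flat₂_balancedPencil hn, rank_normGram (flat₂_ne_zero hS0)] at h2
  have h3 := rank_eq_of_spec_eq s3
  have q2 := mul_self_eq_smul_of_spec_eq s2 (n : ℝ)⁻¹ (by
    rw [normGram_flat₂_balancedPencil hn, Matrix.diagonal_mul_diagonal, ← Matrix.diagonal_smul]
    congr 1
    ext j
    simp only [Pi.smul_apply, smul_eq_mul]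
    split_ifs <;> simp)
  have q3 := mul_self_eq_smul_of_spec_eq s3 ((n : ℝ) + 1)⁻¹ (by
    rw [normGram_flat₃_balancedPencil hn, Matrix.smul_mul, Matrix.one_mul])
  have hn' : (0 : ℝ) < n := by exact_mod_cast hn
  have r3 : (normGram (flat₃ (balancedPencil n))).rank = n + 1 := by
    have : ((((n : ℝ) + 1)⁻¹ : ℝ) : ℂ) ≠ 0 := by
      exact_mod_cast (inv_pos.2 (by linarith : (0 : ℝ) < n + 1)).ne'
    rw [normGram_flat₃_balancedPencil hn,
      Matrix.rank_smul_of_mem_nonZeroDivisors _ (mem_nonZeroDivisors_of_ne_zero this)]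
    simp
  have h4 := hT.le_of_mem_closure_orbit hS hS0
    (h1 ▸ rank_flat₁_balancedPencil_le n) (inv_pos.2 hn') q2 (by simp [← h2])
    (eq_smul_one_of_mul_self_eq q3 (h3.symm.trans r3))
  -- The separating inequality reads `1/n ≤ 1/(n+1)`.
  rw [inv_le_inv₀ hn' (by linarith)] at h4
  linarith

theorem momentPolytope_unitTensor_sq_not_subset {m : ℕ} (hm : 2 ≤ m) :
    ¬ momentPolytope (unitTensor (m ^ 2)) ⊆ momentPolytope (matMulTensor m m m) := by
  -- The size is generalized to a variable so that `m * m`, which occurs in the types, can be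
  -- replaced by a successor.
  have key : ∀ (r : ℕ) (T : Tensor (Fin r) (Fin r) (Fin r)), 2 ≤ r → HasCorankTwoPencils T →
      ¬ momentPolytope (unitTensor r) ⊆ momentPolytope T := by
    intro r T hr hT
    obtain ⟨n, rfl⟩ : ∃ n, r = n + 1 := ⟨r - 1, by omega⟩
    exact momentPolytope_unitTensor_not_subset (by omega) hT
  rw [sq]
  exact key _ _ (by nlinarith) (hasCorankTwoPencils_matMulTensor hm)

/-! ### Unit tensors from diagonal subsets of a support. -/

section Diagonal

variable {α β γ : Type} [Fintype α] [Fintype β] [Fintype γ]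

theorem kronPow_unitTensor_apply {r n : ℕ} (i j k : Fin n → Fin r) :
    kronPow (unitTensor r) n i j k = if i = j ∧ j = k then 1 else 0 := by
  simp only [kronPow, unitTensor_apply]
  split_ifs with h
  · obtain ⟨rfl, rfl⟩ := h
    simp
  · by_contra h0
    rw [Finset.prod_eq_zero_iff] at h0
    push Not at h0
    refine h ⟨funext fun t => ?_, funext fun t => ?_⟩
    · have := h0 t (Finset.mem_univ t)
      simp only [ne_eq, ite_eq_right_iff, one_ne_zero, imp_false, not_not] at this
      exact this.1
    · have := h0 t (Finset.mem_univ t)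
      simp only [ne_eq, ite_eq_right_iff, one_ne_zero, imp_false, not_not] at this
      exact this.2

/-- A set of at least `r ^ n` support points of `T` which are diagonal in the support of `T` yields a
restriction of the unit tensor. -/
theorem kronPow_unitTensor_restricts_of_diagonal {ι : Type} (T : Tensor α β γ) (I : Finset ι)
    (x : ι → α) (y : ι → β) (z : ι → γ) (h0 : ∀ p ∈ I, T (x p) (y p) (z p) ≠ 0)
    (h1 : ∀ p ∈ I, ∀ q ∈ I, ∀ s ∈ I, T (x p) (y q) (z s) ≠ 0 → p = q ∧ q = s)
    {r n : ℕ} (hI : r ^ n ≤ I.card) : Restricts (kronPow (unitTensor r) n) T := by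
  classical
  have hcard : Fintype.card (Fin n → Fin r) ≤ Fintype.card I := by simpa using hI
  obtain ⟨e⟩ := Function.Embedding.nonempty_of_card_le hcard
  refine ⟨fun a i => if i = x (e a) then (T (x (e a)) (y (e a)) (z (e a)))⁻¹ else 0,
    fun b j => if j = y (e b) then 1 else 0, fun c k => if k = z (e c) then 1 else 0, ?_⟩
  ext a b c
  rw [kronPow_unitTensor_apply]
  simp only [act, ite_mul, zero_mul, mul_ite, mul_one, mul_zero, Finset.sum_ite_eq',
    Finset.mem_univ, if_true]
  split_ifs with h
  · obtain ⟨rfl, rfl⟩ := h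
    rw [inv_mul_cancel₀ (h0 _ (e a).2)]
  · have hz : T (x (e a)) (y (e b)) (z (e c)) = 0 := by
      by_contra hne
      obtain ⟨h2, h3⟩ := h1 _ (e a).2 _ (e b).2 _ (e c).2 hne
      exact h ⟨e.injective (Subtype.ext h2), e.injective (Subtype.ext h3)⟩
    rw [hz, mul_zero]

end Diagonal

/-! ### Absorbing a subexponential loss into sublinearly many extra factors. -/

section Asymptotics

variable {α β γ : Type} [Fintype α] [Fintype β] [Fintype γ]

/-- Powers of `T` restricting to unit tensors with a subexponential loss give an asymptotic
restriction. -/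
theorem asympRestricts_unitTensor_of_subexponential {r : ℕ} (hr : 2 ≤ r) (T : Tensor α β γ) (C : ℝ)
    (h : ∀ n N : ℕ, 2 ≤ N → (r : ℝ) ^ n ≤ (r : ℝ) ^ N * Real.exp (-(C * (√N + 1))) →
      Restricts (kronPow (unitTensor r) n) (kronPow T N)) :
    AsympRestricts (unitTensor r) T := by
  have hr1 : (1 : ℝ) < r := by exact_mod_cast hr
  have hlog : 0 < Real.log r := Real.log_pos hr1
  obtain ⟨q, hq⟩ := exists_nat_ge (|C| / Real.log r)
  -- With `s = Nat.sqrt n + 1` and `N = n + κ * s`, this gives `√N ≤ (q + 2) * s`. The loss exponent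
  -- is then at most `q * (q + 3) * s * log r`, which the extra `κ * s` factors cover because `q *
  -- (q + 3) ≤ κ`.
  let κ : ℕ := (q + 2) ^ 2 - 1
  have hκ : (κ : ℝ) + 1 = ((q : ℝ) + 2) ^ 2 := by
    have : κ + 1 = (q + 2) ^ 2 := Nat.sub_add_cancel (Nat.one_le_pow _ _ (by omega))
    exact_mod_cast this
  have hκ2 : 2 ≤ κ := by
    have : (2 : ℝ) ≤ κ := by nlinarith [(Nat.cast_nonneg q : (0 : ℝ) ≤ q)]
    exact_mod_cast this
  refine ⟨fun n => κ * (Nat.sqrt n + 1), ?_, fun n => ?_⟩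
  · have hb : ∀ n : ℕ, ((κ * (Nat.sqrt n + 1) : ℕ) : ℝ) / n ≤ κ * ((√n)⁻¹ + (n : ℝ)⁻¹) := by
      intro n
      have h1 : (Nat.sqrt n : ℝ) ≤ √n := Real.nat_sqrt_le_real_sqrt
      have h2 : √(n : ℝ) / n = (√n)⁻¹ := Real.sqrt_div_self
      rw [← h2, inv_eq_one_div, ← add_div, ← mul_div_assoc]
      push_cast
      gcongr
    refine squeeze_zero (fun n => by positivity) hb ?_
    have h1 : Filter.Tendsto (fun n : ℕ => (√(n : ℝ))⁻¹) Filter.atTop (nhds 0) :=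
      (Real.tendsto_sqrt_atTop.comp tendsto_natCast_atTop_atTop).inv_tendsto_atTop
    have h2 : Filter.Tendsto (fun n : ℕ => ((n : ℝ))⁻¹) Filter.atTop (nhds 0) :=
      tendsto_natCast_atTop_atTop.inv_tendsto_atTop
    simpa using (h1.add h2).const_mul (κ : ℝ)
  · set s : ℕ := Nat.sqrt n + 1 with hs
    have hs1 : (1 : ℝ) ≤ s := by rw [hs]; push_cast; linarith [(Nat.cast_nonneg (Nat.sqrt n) : (0 : ℝ) ≤ _)]
    have hns : (n : ℝ) ≤ (s : ℝ) ^ 2 := by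
      have := Nat.lt_succ_sqrt' n
      exact_mod_cast this.le
    refine h n (n + κ * s) (by nlinarith [Nat.succ_pos (Nat.sqrt n)]) ?_
    have hsq : √((n + κ * s : ℕ) : ℝ) ≤ (q + 2) * s := by
      refine Real.sqrt_le_iff.2 ⟨by positivity, ?_⟩
      rw [mul_pow, ← hκ]
      push_cast
      have h1 : (s : ℝ) ≤ (s : ℝ) ^ 2 := by nlinarith
      have h2 := mul_le_mul_of_nonneg_left h1 (Nat.cast_nonneg κ : (0 : ℝ) ≤ κ)
      linarith
    have hC : C * (√((n + κ * s : ℕ) : ℝ) + 1) ≤ (κ * s) * Real.log r := by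
      have h1 : |C| ≤ q * Real.log r := by rwa [div_le_iff₀ hlog] at hq
      calc C * (√((n + κ * s : ℕ) : ℝ) + 1) ≤ |C| * (√((n + κ * s : ℕ) : ℝ) + 1) := by
            gcongr
            exact le_abs_self C
        _ ≤ (q * Real.log r) * ((q + 2) * s + s) := by gcongr
        _ = (q * (q + 3)) * s * Real.log r := by ring
        _ ≤ (κ * s) * Real.log r := by
            gcongr
            nlinarith [(Nat.cast_nonneg q : (0 : ℝ) ≤ q)]
    have h2 : Real.exp (C * (√((n + κ * s : ℕ) : ℝ) + 1)) ≤ (r : ℝ) ^ (κ * s) := by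
      rw [← Real.exp_log (show (0 : ℝ) < (r : ℝ) ^ (κ * s) by positivity), Real.log_pow]
      push_cast at hC ⊢
      exact Real.exp_le_exp.2 hC
    rw [Real.exp_neg, ← div_eq_mul_inv, le_div_iff₀ (Real.exp_pos _), pow_add]
    gcongr

end Asymptotics

/-- A set of integers below `K` without three-term progressions of nearly full size. -/
theorem exists_threeAPFree (K : ℕ) : ∃ A ⊆ Finset.range K, ThreeAPFree (A : Set ℕ) ∧
    (K : ℝ) * Real.exp (-4 * √(Real.log K)) ≤ A.card := by
  obtain ⟨A, hA, hc, hf⟩ := rothNumberNat_spec K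
  exact ⟨A, hA, hf, hc ▸ Behrend.roth_lower_bound⟩

/-! ### Ruzsa–Szemerédi triangles in powers of matrix multiplication. -/

theorem matMulTensor_self_ne_zero_iff {m : ℕ} (a b c : Fin m × Fin m) :
    matMulTensor m m m (finProdFinEquiv a) (finProdFinEquiv b) (finProdFinEquiv c) ≠ 0 ↔
      a.2 = b.1 ∧ b.2 = c.1 ∧ c.2 = a.1 := by
  rw [matMulTensor_apply]
  simp

/-- A Ruzsa–Szemerédi family of triangles restricts a power of the matrix multiplication tensor to a
unit tensor. -/
theorem kronPow_unitTensor_restricts_kronPow_matMulTensor {m n N L : ℕ} {A : Finset ℕ}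
    (hA : A ⊆ Finset.range L) (hAP : ThreeAPFree (A : Set ℕ)) (hL : 3 * L ≤ m ^ N)
    (hcard : (m ^ 2) ^ n ≤ L * A.card) :
    Restricts (kronPow (unitTensor (m ^ 2)) n) (kronPow (matMulTensor m m m) N) := by
  classical
  rcases Nat.eq_zero_or_pos L with rfl | hL0
  · have hAe : A = ∅ := by simpa using hA
    refine kronPow_unitTensor_restricts_of_diagonal _ (∅ : Finset Empty) (fun p => p.elim)
      (fun p => p.elim) (fun p => p.elim) (by simp) (by simp) (by simpa using hcard)
  have hpos : 0 < m ^ N := by omega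
  -- Base `m` digits label the vertices. The reduction only makes `W` total: every vertex used is
  -- below `3 * L ≤ m ^ N`.
  let W : ℕ → Fin N → Fin m := fun u => finFunctionFinEquiv.symm (⟨u % m ^ N, Nat.mod_lt _ hpos⟩)
  have hW : ∀ u v, u < m ^ N → v < m ^ N → W u = W v → u = v := by
    intro u v hu hv h
    have := finFunctionFinEquiv.symm.injective h
    simpa [Fin.ext_iff, Nat.mod_eq_of_lt hu, Nat.mod_eq_of_lt hv] using this
  let P : (Fin N → Fin m) → (Fin N → Fin m) → Fin N → Fin (m * m) := fun u v t =>
    finProdFinEquiv (u t, v t)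
  have hval : ∀ u v v' w w' u', kronPow (matMulTensor m m m) N (P u v) (P v' w) (P w' u') ≠ 0 ↔
      v = v' ∧ w = w' ∧ u' = u := by
    intro u v v' w w' u'
    simp only [kronPow, P, Finset.prod_ne_zero_iff, Finset.mem_univ, true_imp_iff,
      matMulTensor_self_ne_zero_iff]
    constructor
    · intro h
      exact ⟨funext fun t => (h t).1, funext fun t => (h t).2.1, funext fun t => (h t).2.2⟩
    · rintro ⟨rfl, rfl, rfl⟩ t
      exact ⟨rfl, rfl, rfl⟩
  refine kronPow_unitTensor_restricts_of_diagonal _ (Finset.range L ×ˢ A)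
    (fun p => P (W p.1) (W (p.1 + p.2))) (fun p => P (W (p.1 + p.2)) (W (p.1 + 2 * p.2)))
    (fun p => P (W (p.1 + 2 * p.2)) (W p.1)) ?_ ?_ (by simpa using hcard)
  · intro p _
    exact (hval _ _ _ _ _ _).2 ⟨rfl, rfl, rfl⟩
  · rintro ⟨x, a⟩ hp ⟨x', a'⟩ hp' ⟨x'', a''⟩ hp'' h
    simp only [Finset.mem_product, Finset.mem_range] at hp hp' hp''
    have ha := Finset.mem_range.1 (hA hp.2)
    have ha' := Finset.mem_range.1 (hA hp'.2)
    have ha'' := Finset.mem_range.1 (hA hp''.2)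
    obtain ⟨h1, h2, h3⟩ := (hval _ _ _ _ _ _).1 h
    have e1 := hW _ _ (by simp only; omega) (by simp only; omega) h1
    have e2 := hW _ _ (by simp only; omega) (by simp only; omega) h2
    have e3 := hW _ _ (by simp only; omega) (by simp only; omega) h3
    simp only at e1 e2 e3
    -- The three vertex identities combine to `a + a' = 2 * a''`, a progression in `A`.
    have e4 := hAP hp.2 hp''.2 hp'.2 (by omega)
    simp only [Prod.mk.injEq]
    omega

theorem asympRestricts_unitTensor_matMulTensor {m : ℕ} (hm : 2 ≤ m) :
    AsympRestricts (unitTensor (m ^ 2)) (matMulTensor m m m) := by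
  have hm1 : (1 : ℝ) < m := by exact_mod_cast hm
  have hlog : 0 < Real.log m := Real.log_pos hm1
  refine asympRestricts_unitTensor_of_subexponential (by nlinarith) _ (4 + 4 * √(Real.log m)) ?_
  intro n N hN h
  set L := m ^ N / 3 with hL
  obtain ⟨A, hA, hAP, hc⟩ := exists_threeAPFree L
  refine kronPow_unitTensor_restricts_kronPow_matMulTensor hA hAP (Nat.mul_div_le _ _) ?_
  have hq : 4 ≤ m ^ N := by
    calc 4 = 2 ^ 2 := rfl
      _ ≤ m ^ 2 := Nat.pow_le_pow_left hm 2
      _ ≤ m ^ N := Nat.pow_le_pow_right (by omega) hN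
  have hL6 : m ^ N ≤ 6 * L := by omega
  have hLpos : 0 < L := by omega
  have hLle : L ≤ m ^ N := Nat.div_le_self _ _
  have hL6' : (m : ℝ) ^ N ≤ 6 * L := by exact_mod_cast hL6
  have hLle' : (L : ℝ) ≤ (m : ℝ) ^ N := by exact_mod_cast hLle
  have hLpos' : (0 : ℝ) < L := by exact_mod_cast hLpos
  have hsq : √(Real.log L) ≤ √N * √(Real.log m) := by
    rw [← Real.sqrt_mul (Nat.cast_nonneg N)]
    refine Real.sqrt_le_sqrt ?_
    rw [← Real.log_pow]
    exact Real.log_le_log hLpos' hLle'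
  -- Rounding in `L = m ^ N / 3` costs `m ^ N ≤ 6 * L`; its square is paid for by the constant `4`
  -- in the exponent.
  have h36 : (36 : ℝ) ≤ Real.exp 4 := by
    have h1 := Real.exp_one_gt_d9
    have h2 : Real.exp 4 = Real.exp 1 ^ 4 := by rw [← Real.exp_nat_mul]; norm_num
    rw [h2]
    calc (36 : ℝ) ≤ (2.7 : ℝ) ^ 4 := by norm_num
      _ ≤ _ := by gcongr; linarith
  have hfin : ((m ^ 2 : ℕ) : ℝ) ^ n ≤ L * A.card := by
    refine h.trans ?_
    have h5 : Real.exp (-((4 + 4 * √(Real.log m)) * (√N + 1))) ≤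
        Real.exp (-4) * Real.exp (-4 * √(Real.log L)) := by
      rw [← Real.exp_add]
      refine Real.exp_le_exp.2 ?_
      nlinarith [Real.sqrt_nonneg (N : ℝ), Real.sqrt_nonneg (Real.log m)]
    have h6 : ((m ^ 2 : ℕ) : ℝ) ^ N ≤ 36 * L ^ 2 := by
      push_cast
      rw [← pow_mul, mul_comm, pow_mul]
      calc ((m : ℝ) ^ N) ^ 2 ≤ (6 * L) ^ 2 := by gcongr
        _ = _ := by ring
    calc _ ≤ (36 * L ^ 2) * (Real.exp (-4) * Real.exp (-4 * √(Real.log L))) := by gcongr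
      _ ≤ (Real.exp 4 * L ^ 2) * (Real.exp (-4) * Real.exp (-4 * √(Real.log L))) := by gcongr
      _ = L * (L * Real.exp (-4 * √(Real.log L))) := by
          rw [Real.exp_neg 4]
          field_simp
      _ ≤ L * A.card := by gcongr
  exact_mod_cast hfin

/-! ### Affine hashing of the support of powers of the wedge tensor. -/

section Hashing

open Matrix

theorem wedgeTensor_ne_zero_iff (i j k : Fin 3) :
    wedgeTensor i j k ≠ 0 ↔ ∃ σ : Equiv.Perm (Fin 3), σ 0 = i ∧ σ 1 = j ∧ σ 2 = k := by
  have h1 : wedgeTensor i j k ≠ 0 ↔ i ≠ j ∧ j ≠ k ∧ i ≠ k := by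
    fin_cases i <;> fin_cases j <;> fin_cases k <;> simp [wedgeTensor, basisTensor]
  rw [h1]
  clear h1
  revert i j k
  decide

theorem perm_fin_three_ext {σ τ : Equiv.Perm (Fin 3)} (h0 : σ 0 = τ 0) (h1 : σ 1 = τ 1) :
    σ = τ := by
  revert σ τ
  decide

theorem perm_fin_three_sum (σ : Equiv.Perm (Fin 3)) :
    (σ 0 : ℕ) + (σ 1 : ℕ) + (σ 2 : ℕ) = 3 := by
  revert σ
  decide

theorem card_perm_fin_three_apply_eq (c i : Fin 3) :
    (Finset.univ.filter fun σ : Equiv.Perm (Fin 3) => σ c = i).card = 2 := by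
  revert c i
  decide

variable {N M : ℕ}

/-- The `c`-th index word of a support point of the `N`-th power of `wedgeTensor`, which is given by
a word of permutations. -/
def word (p : Fin N → Equiv.Perm (Fin 3)) (c : Fin 3) : Fin N → Fin 3 := fun t => p t c

/-- An index word as a vector over `ZMod M`. -/
def wordVec (M : ℕ) (x : Fin N → Fin 3) : Fin N → ZMod M := fun t => ((x t : ℕ) : ZMod M)

theorem word_ext {p q : Fin N → Equiv.Perm (Fin 3)} (h0 : word p 0 = word q 0)
    (h1 : word p 1 = word q 1) : p = q :=
  funext fun t => perm_fin_three_ext (congrFun h0 t) (congrFun h1 t)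

theorem wordVec_injective (hM : 3 ≤ M) : Function.Injective (wordVec (N := N) M) := by
  intro x y h
  ext t
  have h1 := congrFun h t
  simp only [wordVec] at h1
  rw [ZMod.natCast_eq_natCast_iff', Nat.mod_eq_of_lt (by omega), Nat.mod_eq_of_lt (by omega)] at h1
  exact h1

/-- Tightness of the support, up to a shift: affine hashes of the first two words determine the hash
of the third. -/
theorem wordVec_sum (p : Fin N → Equiv.Perm (Fin 3)) :
    wordVec M (word p 0) + wordVec M (word p 1) + wordVec M (word p 2) = fun _ => 3 := by
  ext t
  have := congrArg (Nat.cast : ℕ → ZMod M) (perm_fin_three_sum (p t))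
  simpa [wordVec, word] using this

theorem kronPow_wedgeTensor_ne_zero_iff (x y z : Fin N → Fin 3) :
    kronPow wedgeTensor N x y z ≠ 0 ↔ ∃ p, word p 0 = x ∧ word p 1 = y ∧ word p 2 = z := by
  simp only [kronPow, Finset.prod_ne_zero_iff, Finset.mem_univ, true_imp_iff,
    wedgeTensor_ne_zero_iff]
  constructor
  · intro h
    choose p hp using h
    exact ⟨p, funext fun t => (hp t).1, funext fun t => (hp t).2.1, funext fun t => (hp t).2.2⟩
  · rintro ⟨p, rfl, rfl, rfl⟩ t
    exact ⟨p t, rfl, rfl, rfl⟩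

/-- The two support points are distinct and share an index word. -/
def Conflict (p q : Fin N → Equiv.Perm (Fin 3)) : Prop := p ≠ q ∧ ∃ c, word p c = word q c

/-- The affine hash function `(w, u, v)` maps the first two index words of `p` to `a`. -/
def Hashes (ω : (Fin N → ZMod M) × ZMod M × ZMod M) (a : ZMod M)
    (p : Fin N → Equiv.Perm (Fin 3)) : Prop :=
  ω.1 ⬝ᵥ wordVec M (word p 0) + ω.2.1 = a ∧ ω.1 ⬝ᵥ wordVec M (word p 1) + ω.2.2 = a

open Classical in
/-- The support points with hash value `a` which are in conflict with no other such point. -/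
def isolated (ω : (Fin N → ZMod M) × ZMod M × ZMod M) (a : ZMod M) :
    Finset (Fin N → Equiv.Perm (Fin 3)) :=
  Finset.univ.filter fun p => Hashes ω a p ∧ ∀ q, Hashes ω a q → ¬ Conflict p q

open Classical in
theorem card_conflict_le (N : ℕ) :
    (Finset.univ.filter fun e : (Fin N → Equiv.Perm (Fin 3)) × (Fin N → Equiv.Perm (Fin 3)) =>
      Conflict e.1 e.2).card ≤ 3 * 12 ^ N := by
  have h1 : ∀ (p : Fin N → Equiv.Perm (Fin 3)) (c : Fin 3),
      (Finset.univ.filter fun q => word p c = word q c).card = 2 ^ N := by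
    intro p c
    have : (Finset.univ.filter fun q => word p c = word q c) =
        Fintype.piFinset fun t => Finset.univ.filter fun σ : Equiv.Perm (Fin 3) => σ c = p t c := by
      ext q
      simp only [Finset.mem_filter, Finset.mem_univ, true_and, Fintype.mem_piFinset, funext_iff, word]
      exact forall_congr' fun t => eq_comm
    rw [this, Fintype.card_piFinset]
    simp [card_perm_fin_three_apply_eq]
  calc _ ≤ (Finset.univ.biUnion fun c : Fin 3 => Finset.univ.filter
        fun e : (Fin N → Equiv.Perm (Fin 3)) × (Fin N → Equiv.Perm (Fin 3)) =>
          word e.1 c = word e.2 c).card := by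
        refine Finset.card_le_card fun e he => ?_
        obtain ⟨c, hc⟩ := (Finset.mem_filter.1 he).2.2
        exact Finset.mem_biUnion.2 ⟨c, Finset.mem_univ _, Finset.mem_filter.2 ⟨Finset.mem_univ _, hc⟩⟩
    _ ≤ ∑ c : Fin 3, (Finset.univ.filter
        fun e : (Fin N → Equiv.Perm (Fin 3)) × (Fin N → Equiv.Perm (Fin 3)) =>
          word e.1 c = word e.2 c).card := Finset.card_biUnion_le
    _ = ∑ c : Fin 3, 12 ^ N := by
        refine Finset.sum_congr rfl fun c _ => ?_
        rw [Finset.card_filter, Fintype.sum_prod_type]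
        simp only [← Finset.card_filter, h1, Finset.sum_const, Finset.card_univ, Fintype.card_pi,
          Fintype.card_perm, Fintype.card_fin, Finset.prod_const, smul_eq_mul]
        rw [← mul_pow]
        rfl
    _ = 3 * 12 ^ N := by simp

/-- For each `w` exactly one pair of shifts `(u, v)` sends `p` to `a`, so conditioning on `p` leaves
`w` uniform. -/
theorem card_hashes_and [NeZero M] (a : ZMod M) (p : Fin N → Equiv.Perm (Fin 3))
    (Q : (Fin N → ZMod M) → Prop) [DecidablePred Q]
    [DecidablePred fun ω : (Fin N → ZMod M) × ZMod M × ZMod M => Hashes ω a p ∧ Q ω.1] :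
    (Finset.univ.filter fun ω : (Fin N → ZMod M) × ZMod M × ZMod M => Hashes ω a p ∧ Q ω.1).card =
      (Finset.univ.filter Q).card := by
  symm
  refine Finset.card_bij (fun w _ => (w, a - w ⬝ᵥ wordVec M (word p 0),
    a - w ⬝ᵥ wordVec M (word p 1))) ?_ ?_ ?_
  · intro w hw
    exact Finset.mem_filter.2 ⟨Finset.mem_univ _, ⟨sub_eq_iff_eq_add'.1 rfl |>.symm,
      sub_eq_iff_eq_add'.1 rfl |>.symm⟩, (Finset.mem_filter.1 hw).2⟩
  · intro w _ w' _ h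
    exact (Prod.mk.inj h).1
  · rintro ⟨w, u, v⟩ h
    obtain ⟨⟨h1, h2⟩, h3⟩ := (Finset.mem_filter.1 h).2
    exact ⟨w, Finset.mem_filter.2 ⟨Finset.mem_univ _, h3⟩, Prod.ext rfl
      (Prod.ext (sub_eq_of_eq_add' h1.symm) (sub_eq_of_eq_add' h2.symm))⟩

open Classical in
theorem mul_card_dotProduct_eq_zero_le [Fact M.Prime] {d : Fin N → ZMod M} (hd : d ≠ 0) :
    M * (Finset.univ.filter fun w : Fin N → ZMod M => w ⬝ᵥ d = 0).card ≤ M ^ N := by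
  obtain ⟨t, ht⟩ := Function.ne_iff.1 hd
  have h : ((Finset.univ : Finset (ZMod M)) ×ˢ
      (Finset.univ.filter fun w : Fin N → ZMod M => w ⬝ᵥ d = 0)).card ≤
      (Finset.univ : Finset (Fin N → ZMod M)).card := by
    -- Translates of the hyperplane along a coordinate `t` with `d t ≠ 0` are disjoint.
    refine Finset.card_le_card_of_injOn (fun e => e.2 + Pi.single t e.1) (fun _ _ => by simp) ?_
    rintro ⟨s, w⟩ hw ⟨s', w'⟩ hw' h
    simp only [Finset.coe_product, Set.mem_prod, Finset.mem_coe, Finset.mem_filter, Finset.mem_univ,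
      true_and] at hw hw' h
    have h1 := congrArg (fun z => z ⬝ᵥ d) h
    simp only [add_dotProduct, hw, hw', single_dotProduct, zero_add] at h1
    have h2 : s = s' := mul_right_cancel₀ ht h1
    subst h2
    rw [add_right_cancel h]
  simpa using h

open Classical in
/-- Averaging over the hash functions, isolated support points with a fixed hash value make up at
least half of the expected number of support points with that value. -/
theorem le_two_mul_sum_card_isolated [Fact M.Prime] (hM : 6 * 2 ^ N ≤ M) (a : ZMod M) :
    6 ^ N * M ^ N ≤ 2 * ∑ ω : (Fin N → ZMod M) × ZMod M × ZMod M, (isolated ω a).card := by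
  have hM3 : 3 ≤ M := by
    have := Nat.one_le_two_pow (n := N)
    omega
  have hM0 : 0 < M := by omega
  have hcount : ∑ ω : (Fin N → ZMod M) × ZMod M × ZMod M,
      (Finset.univ.filter fun p => Hashes ω a p).card = 6 ^ N * M ^ N := by
    simp only [Finset.card_filter]
    rw [Finset.sum_comm]
    simp only [← Finset.card_filter]
    have : ∀ p : Fin N → Equiv.Perm (Fin 3), (Finset.univ.filter
        fun ω : (Fin N → ZMod M) × ZMod M × ZMod M => Hashes ω a p).card = M ^ N := fun p => by
      have := card_hashes_and a p fun _ => True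
      simpa using this
    simp only [this]
    simp [Fintype.card_perm, Nat.factorial]
  -- Conflicting points differ in their first or second word. If both hash to `a`, that nonzero
  -- difference `d` satisfies `w ⬝ᵥ d = 0`, which costs a further factor `M`.
  have hpairs : M * ∑ ω : (Fin N → ZMod M) × ZMod M × ZMod M, (Finset.univ.filter
      fun e : (Fin N → Equiv.Perm (Fin 3)) × (Fin N → Equiv.Perm (Fin 3)) =>
        Conflict e.1 e.2 ∧ Hashes ω a e.1 ∧ Hashes ω a e.2).card ≤ 3 * 12 ^ N * M ^ N := by
    simp only [Finset.card_filter]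
    rw [Finset.sum_comm, Finset.mul_sum]
    simp only [← Finset.card_filter]
    calc _ ≤ ∑ e : (Fin N → Equiv.Perm (Fin 3)) × (Fin N → Equiv.Perm (Fin 3)),
          if Conflict e.1 e.2 then M ^ N else 0 := by
          refine Finset.sum_le_sum fun e _ => ?_
          split_ifs with he
          · have hd : ∃ d : Fin N → ZMod M, d ≠ 0 ∧ ∀ ω, Hashes ω a e.1 → Hashes ω a e.2 →
                ω.1 ⬝ᵥ d = 0 := by
              by_cases h0 : word e.1 0 = word e.2 0
              · refine ⟨wordVec M (word e.1 1) - wordVec M (word e.2 1), fun h => ?_,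
                  fun ω h1 h2 => ?_⟩
                · exact he.1 (word_ext h0 (wordVec_injective hM3 (sub_eq_zero.1 h)))
                · rw [dotProduct_sub]
                  linear_combination h1.2 - h2.2
              · refine ⟨wordVec M (word e.1 0) - wordVec M (word e.2 0), fun h => ?_,
                  fun ω h1 h2 => ?_⟩
                · exact h0 (wordVec_injective hM3 (sub_eq_zero.1 h))
                · rw [dotProduct_sub]
                  linear_combination h1.1 - h2.1
            obtain ⟨d, hd0, hd⟩ := hd
            refine le_trans (Nat.mul_le_mul_left M ?_) (mul_card_dotProduct_eq_zero_le hd0)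
            refine le_trans ?_ (card_hashes_and a e.1 fun w => w ⬝ᵥ d = 0).le
            refine Finset.card_le_card fun ω hω => ?_
            simp only [Finset.mem_filter, Finset.mem_univ, true_and] at hω ⊢
            exact ⟨hω.2.1, hd ω hω.2.1 hω.2.2⟩
          · simp [he]
      _ = (Finset.univ.filter fun e : (Fin N → Equiv.Perm (Fin 3)) ×
            (Fin N → Equiv.Perm (Fin 3)) => Conflict e.1 e.2).card * M ^ N := by
          rw [← Finset.sum_filter, Finset.sum_const, smul_eq_mul]
      _ ≤ 3 * 12 ^ N * M ^ N := Nat.mul_le_mul_right _ (card_conflict_le N)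
  -- A hashed point that is not isolated is the first member of some conflicting pair.
  have hiso : ∀ ω : (Fin N → ZMod M) × ZMod M × ZMod M,
      (Finset.univ.filter fun p => Hashes ω a p).card ≤ (isolated ω a).card + (Finset.univ.filter
      fun e : (Fin N → Equiv.Perm (Fin 3)) × (Fin N → Equiv.Perm (Fin 3)) =>
        Conflict e.1 e.2 ∧ Hashes ω a e.1 ∧ Hashes ω a e.2).card := by
    intro ω
    refine le_trans (Finset.card_le_card (t := isolated ω a ∪ (Finset.univ.filter
      fun e : (Fin N → Equiv.Perm (Fin 3)) × (Fin N → Equiv.Perm (Fin 3)) =>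
        Conflict e.1 e.2 ∧ Hashes ω a e.1 ∧ Hashes ω a e.2).image Prod.fst) ?_)
      ((Finset.card_union_le _ _).trans (Nat.add_le_add_left Finset.card_image_le _))
    intro p hp
    have hp' := (Finset.mem_filter.1 hp).2
    by_cases h : ∀ q, Hashes ω a q → ¬ Conflict p q
    · exact Finset.mem_union_left _ (Finset.mem_filter.2 ⟨Finset.mem_univ _, hp', h⟩)
    · push Not at h
      obtain ⟨q, hq, hpq⟩ := h
      exact Finset.mem_union_right _ (Finset.mem_image.2 ⟨(p, q), Finset.mem_filter.2
        ⟨Finset.mem_univ _, hpq, hp', hq⟩, rfl⟩)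
  have hsum := Finset.sum_le_sum fun ω (_ : ω ∈ Finset.univ) => hiso ω
  rw [hcount, Finset.sum_add_distrib] at hsum
  set G := ∑ ω : (Fin N → ZMod M) × ZMod M × ZMod M, (isolated ω a).card
  refine Nat.le_of_mul_le_mul_left ?_ hM0
  have h1 := Nat.mul_le_mul_left M hsum
  have h12 : (12 : ℕ) ^ N = 6 ^ N * 2 ^ N := by rw [← mul_pow]; norm_num
  have h2 : 2 * (3 * 12 ^ N * M ^ N) ≤ M * (6 ^ N * M ^ N) := by
    calc 2 * (3 * 12 ^ N * M ^ N) = (6 * 2 ^ N) * (6 ^ N * M ^ N) := by rw [h12]; ring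
      _ ≤ _ := Nat.mul_le_mul_right _ hM
  rw [Nat.mul_add] at h1
  linarith

theorem exists_hash [Fact M.Prime] (hM : 6 * 2 ^ N ≤ M) (A : Finset ℕ) :
    ∃ ω : (Fin N → ZMod M) × ZMod M × ZMod M,
      A.card * 6 ^ N ≤ 2 * M ^ 2 * ∑ a ∈ A, (isolated ω (a : ZMod M)).card := by
  by_contra! hcon
  have hM0 : 0 < M := (Fact.out : M.Prime).pos
  have h1 := Finset.sum_lt_sum_of_nonempty (s := (Finset.univ :
    Finset ((Fin N → ZMod M) × ZMod M × ZMod M))) Finset.univ_nonempty fun ω _ => hcon ω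
  rw [← Finset.mul_sum, Finset.sum_comm, Finset.sum_const, Finset.card_univ] at h1
  have hc : Fintype.card ((Fin N → ZMod M) × ZMod M × ZMod M) = M ^ N * M ^ 2 := by
    simp [Fintype.card_prod, ZMod.card, sq]
  rw [hc] at h1
  have h2 := Finset.sum_le_sum fun a (_ : a ∈ A) => le_two_mul_sum_card_isolated hM (a : ZMod M)
  rw [Finset.sum_const, ← Finset.mul_sum, smul_eq_mul] at h2
  have h3 := Nat.mul_le_mul_left (M ^ 2) h2
  rw [smul_eq_mul] at h1
  nlinarith

theorem isolated_eq_of_word_eq {ω : (Fin N → ZMod M) × ZMod M × ZMod M} {a : ZMod M}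
    {p q : Fin N → Equiv.Perm (Fin 3)} (hp : p ∈ isolated ω a) (hq : Hashes ω a q) (c : Fin 3)
    (h : word p c = word q c) : p = q := by
  classical
  by_contra hne
  exact (Finset.mem_filter.1 hp).2.2 q hq ⟨hne, c, h⟩

theorem kronPow_unitTensor_restricts_kronPow_wedgeTensor {n K : ℕ} {A : Finset ℕ}
    (hA : A ⊆ Finset.range K) (hAP : ThreeAPFree (A : Set ℕ)) (hK : 2 * K ≤ M)
    (ω : (Fin N → ZMod M) × ZMod M × ZMod M)
    (hcard : 3 ^ n ≤ ∑ a ∈ A, (isolated ω (a : ZMod M)).card) :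
    Restricts (kronPow (unitTensor 3) n) (kronPow wedgeTensor N) := by
  classical
  refine kronPow_unitTensor_restricts_of_diagonal _ (A.sigma fun a => isolated ω (a : ZMod M))
    (fun e => word e.2 0) (fun e => word e.2 1) (fun e => word e.2 2) ?_ ?_
    (by rwa [Finset.card_sigma])
  · intro e _
    exact (kronPow_wedgeTensor_ne_zero_iff _ _ _).2 ⟨e.2, rfl, rfl, rfl⟩
  · rintro ⟨a, p⟩ hp ⟨a', q⟩ hq ⟨a'', s⟩ hs h
    obtain ⟨ha, hp⟩ := Finset.mem_sigma.1 hp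
    obtain ⟨ha', hq⟩ := Finset.mem_sigma.1 hq
    obtain ⟨ha'', hs⟩ := Finset.mem_sigma.1 hs
    simp only at ha hp ha' hq ha'' hs h
    obtain ⟨τ, h0, h1, h2⟩ := (kronPow_wedgeTensor_ne_zero_iff _ _ _).1 h
    have ep := (Finset.mem_filter.1 hp).2.1
    have eq := (Finset.mem_filter.1 hq).2.1
    have es := (Finset.mem_filter.1 hs).2.1
    -- `τ` and `s` share their third word, so their first two hashes have the same sum. As `2 * K ≤
    -- M`, the identity lifts to the integers, where `A` is progression-free.
    have eτ : ((a + a' : ℕ) : ZMod M) = ((a'' + a'' : ℕ) : ZMod M) := by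
      have s1 := congrArg (fun z => ω.1 ⬝ᵥ z) (wordVec_sum (M := M) τ)
      have s2 := congrArg (fun z => ω.1 ⬝ᵥ z) (wordVec_sum (M := M) s)
      simp only [dotProduct_add, h0, h1, h2] at s1 s2
      push_cast
      linear_combination s1 - s2 - ep.1 - eq.2 + es.1 + es.2
    have la := Finset.mem_range.1 (hA ha)
    have la' := Finset.mem_range.1 (hA ha')
    have la'' := Finset.mem_range.1 (hA ha'')
    rw [ZMod.natCast_eq_natCast_iff', Nat.mod_eq_of_lt (by omega), Nat.mod_eq_of_lt (by omega)] at eτ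
    have haa := hAP ha ha'' ha' eτ
    obtain rfl : a = a'' := haa
    obtain rfl : a = a' := by omega
    -- With equal hash values `τ` itself hashes to `a` and shares a word with each of `p`, `q`, `s`;
    -- isolation identifies all four.
    have hτ : Hashes ω (a : ZMod M) τ := ⟨by rw [h0]; exact ep.1, by rw [h1]; exact eq.2⟩
    obtain rfl := isolated_eq_of_word_eq hp hτ 0 h0.symm
    obtain rfl := isolated_eq_of_word_eq hq hτ 1 h1.symm
    obtain rfl := isolated_eq_of_word_eq hs hτ 2 h2.symm
    exact ⟨rfl, rfl⟩

theorem sqrt_log_six_mul_two_pow_le (N : ℕ) : √(Real.log (6 * 2 ^ N)) ≤ √N + 2 := by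
  refine Real.sqrt_le_iff.2 ⟨by positivity, ?_⟩
  have h1 : Real.log (6 * 2 ^ N) = Real.log 6 + N * Real.log 2 := by
    rw [Real.log_mul (by norm_num) (by positivity), Real.log_pow]
  have h2 : Real.log 2 ≤ 1 := by linarith [Real.log_two_lt_d9]
  have h3 : Real.log 6 ≤ 4 := by
    have : Real.log 6 ≤ Real.log (2 ^ 3) := Real.log_le_log (by norm_num) (by norm_num)
    rw [Real.log_pow] at this
    push_cast at this
    linarith
  have h4 : (√(N : ℝ)) ^ 2 = N := Real.sq_sqrt (Nat.cast_nonneg N)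
  have h5 : (N : ℝ) * Real.log 2 ≤ N := by nlinarith [(Nat.cast_nonneg N : (0 : ℝ) ≤ N)]
  nlinarith [Real.sqrt_nonneg (N : ℝ)]

theorem exp_neg_fourteen_mul_le (N : ℕ) : 192 * Real.exp (-(14 * (√N + 1))) ≤
    Real.exp (-4 * √(Real.log (6 * 2 ^ N))) := by
  have h192 : (192 : ℝ) ≤ Real.exp 6 := by
    have h1 := Real.exp_one_gt_d9
    have h2 : Real.exp 6 = Real.exp 1 ^ 6 := by rw [← Real.exp_nat_mul]; norm_num
    rw [h2]
    calc (192 : ℝ) ≤ (2.7 : ℝ) ^ 6 := by norm_num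
      _ ≤ _ := by gcongr; linarith
  calc 192 * Real.exp (-(14 * (√N + 1))) ≤ Real.exp 6 * Real.exp (-(14 * (√N + 1))) := by gcongr
    _ = Real.exp (6 + -(14 * (√N + 1))) := (Real.exp_add _ _).symm
    _ ≤ _ := by
        refine Real.exp_le_exp.2 ?_
        linarith [Real.sqrt_nonneg (N : ℝ), sqrt_log_six_mul_two_pow_le N]

/-- The constant is `192 = 2 * 4 ^ 2 * 6`: halving for conflicts, `M ≤ 4 * K` squared, and `K = 6 *
2 ^ N`. -/
theorem mul_le_of_card_bounds {N : ℕ} {K M I c ε : ℝ} (hI : 0 ≤ I) (hM0 : 0 ≤ M)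
    (hK : K = 6 * 2 ^ N) (hM : M ≤ 4 * K)
    (hc : K * ε ≤ c) (h : c * 6 ^ N ≤ 2 * M ^ 2 * I) : 3 ^ N * ε ≤ 192 * I := by
  have hKpos : 0 < K := by rw [hK]; positivity
  have h1 : (K * ε) * 6 ^ N ≤ 2 * (4 * K) ^ 2 * I := by
    calc (K * ε) * 6 ^ N ≤ c * 6 ^ N := by gcongr
      _ ≤ 2 * M ^ 2 * I := h
      _ ≤ _ := by gcongr
  have h6 : (6 : ℝ) ^ N = 3 ^ N * 2 ^ N := by rw [← mul_pow]; norm_num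
  have hpos : (0 : ℝ) < K * 2 ^ N := by positivity
  refine le_of_mul_le_mul_left ?_ hpos
  calc K * 2 ^ N * (3 ^ N * ε) = (K * ε) * 6 ^ N := by rw [h6]; ring
    _ ≤ 2 * (4 * K) ^ 2 * I := h1
    _ = K * 2 ^ N * (192 * I) := by rw [hK]; ring

theorem asympRestricts_unitTensor_wedgeTensor : AsympRestricts (unitTensor 3) wedgeTensor := by
  refine asympRestricts_unitTensor_of_subexponential (by norm_num) _ 14 ?_
  intro n N _ h
  obtain ⟨K, hK⟩ : ∃ K, K = 6 * 2 ^ N := ⟨_, rfl⟩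
  have hK0 : 0 < K := by rw [hK]; positivity
  have hK' : (K : ℝ) = 6 * 2 ^ N := by rw [hK]; push_cast; rfl
  obtain ⟨A, hA, hAP, hc⟩ := exists_threeAPFree K
  -- Bertrand's postulate: `M > 2 * K` prevents wraparound of sums from `A` and exceeds `6 * 2 ^ N`,
  -- while `M ≤ 4 * K` limits the loss.
  obtain ⟨M, hMp, hKM, hMK⟩ := Nat.exists_prime_lt_and_le_two_mul (2 * K) (by omega)
  have : Fact M.Prime := ⟨hMp⟩
  obtain ⟨ω, hω⟩ := exists_hash (N := N) (M := M) (by omega) A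
  refine kronPow_unitTensor_restricts_kronPow_wedgeTensor hA hAP hKM.le ω ?_
  generalize ∑ a ∈ A, (isolated ω (a : ZMod M)).card = I at hω ⊢
  have hω' : (A.card : ℝ) * 6 ^ N ≤ 2 * (M : ℝ) ^ 2 * I := by exact_mod_cast hω
  have hMK' : (M : ℝ) ≤ 4 * K := by
    have : M ≤ 4 * K := by omega
    exact_mod_cast this
  have hI := mul_le_of_card_bounds (Nat.cast_nonneg I) (Nat.cast_nonneg M) hK' hMK' hc hω'
  have hexp := exp_neg_fourteen_mul_le N
  rw [← hK'] at hexp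
  have h7 : (192 : ℝ) * 3 ^ n ≤ 192 * I := by
    push_cast at h
    calc (192 : ℝ) * 3 ^ n ≤ 192 * (3 ^ N * Real.exp (-(14 * (√N + 1)))) := by gcongr
      _ = 3 ^ N * (192 * Real.exp (-(14 * (√N + 1)))) := by ring
      _ ≤ 3 ^ N * Real.exp (-4 * √(Real.log K)) := by gcongr
      _ ≤ 192 * I := hI
  have hfin : (3 : ℝ) ^ n ≤ I := by linarith
  exact_mod_cast hfin

end Hashing

/-- Summing out the first leg of `⟨r⟩` with the all-ones functional leaves `∑ e_k ⊗ e_k`, which is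
`matMulTensor 1 1 r`. -/
theorem kronPow_matMulTensor_one_one_restricts_kronPow_unitTensor (r n : ℕ) :
    Restricts (kronPow (matMulTensor 1 1 r) n) (kronPow (unitTensor r) n) := by
  refine ⟨fun _ _ => 1, fun b j => if j = fun t => (finProdFinEquiv.symm (b t)).2 then 1 else 0,
    fun c k => if k = fun t => (finProdFinEquiv.symm (c t)).1 then 1 else 0, ?_⟩
  ext a b c
  have h : ∀ t, matMulTensor 1 1 r (a t) (b t) (c t) =
      if (finProdFinEquiv.symm (b t)).2 = (finProdFinEquiv.symm (c t)).1 then 1 else 0 := fun t => by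
    have := matMulTensor_apply (finProdFinEquiv.symm (a t)) (finProdFinEquiv.symm (b t))
      (finProdFinEquiv.symm (c t))
    simp only [Equiv.apply_symm_apply] at this
    rw [this]
    exact if_congr ⟨fun h => h.2.1, fun h => ⟨Subsingleton.elim _ _, h, Subsingleton.elim _ _⟩⟩ rfl rfl
  simp only [act, kronPow_unitTensor_apply]
  generalize hj : (fun t => (finProdFinEquiv.symm (b t)).2) = j₀
  generalize hk : (fun t => (finProdFinEquiv.symm (c t)).1) = k₀
  have hl : kronPow (matMulTensor 1 1 r) n a b c = if j₀ = k₀ then 1 else 0 := by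
    simp only [kronPow, h, Finset.prod_boole, Finset.mem_univ, true_imp_iff, ← hj, ← hk, funext_iff]
  rw [hl, Finset.sum_eq_single j₀, Finset.sum_eq_single j₀, Finset.sum_eq_single k₀]
  · simp
  · intro k _ hk
    simp [hk]
  · simp
  · intro j _ hj
    simp [hj]
  · simp
  · intro i _ hi
    refine Finset.sum_eq_zero fun j _ => Finset.sum_eq_zero fun k _ => ?_
    split_ifs <;> simp_all
  · simp

theorem asympRestricts_matMulTensor_one_one_three :
    AsympRestricts (matMulTensor 1 1 3) wedgeTensor :=
  AsympRestricts.of_kronPow_restricts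
    (kronPow_matMulTensor_one_one_restricts_kronPow_unitTensor 3)
    asympRestricts_unitTensor_wedgeTensor

end TensorMP
end

theorem theorem1p7 :
    (∃ (a b c a' b' c' : ℕ)
        (S : TensorMP.Tensor (Fin a) (Fin b) (Fin c))
        (T : TensorMP.Tensor (Fin a') (Fin b') (Fin c')),
        TensorMP.AsympRestricts S T ∧
        ¬ TensorMP.momentPolytope S ⊆ TensorMP.momentPolytope T) ∧
    (TensorMP.AsympRestricts (TensorMP.matMulTensor 1 1 3) TensorMP.wedgeTensor ∧
      ¬ TensorMP.momentPolytope (TensorMP.matMulTensor 1 1 3) ⊆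
          TensorMP.momentPolytope TensorMP.wedgeTensor ∧
      (∀ x : Fin 3 → ℂ, (TensorMP.sliceComb x TensorMP.wedgeTensor).det = 0) ∧
      TensorMP.TightSupport TensorMP.wedgeTensor ∧
      TensorMP.AsympRestricts (TensorMP.unitTensor 3) TensorMP.wedgeTensor) ∧
    (∀ m : ℕ, 2 ≤ m →
      TensorMP.AsympRestricts (TensorMP.unitTensor (m ^ 2)) (TensorMP.matMulTensor m m m) ∧
      ¬ TensorMP.momentPolytope (TensorMP.unitTensor (m ^ 2)) ⊆
          TensorMP.momentPolytope (TensorMP.matMulTensor m m m)) := by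
  refine ⟨⟨_, _, _, _, _, _, _, _, TensorMP.asympRestricts_matMulTensor_one_one_three,
    TensorMP.momentPolytope_matMulTensor_one_one_three_not_subset⟩,
    ⟨TensorMP.asympRestricts_matMulTensor_one_one_three,
    TensorMP.momentPolytope_matMulTensor_one_one_three_not_subset,
    TensorMP.det_sliceComb_wedgeTensor, TensorMP.tightSupport_wedgeTensor,
    TensorMP.asympRestricts_unitTensor_wedgeTensor⟩, fun m hm =>
    ⟨TensorMP.asympRestricts_unitTensor_matMulTensor hm,
    TensorMP.momentPolytope_unitTensor_sq_not_subset hm⟩⟩
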